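/- **Setting.** For $u\in L^2(\mathbb R)$ let $\|u\|_{BV(\mathbb R)}=|Du|(\mathbb R)=\sup\{\int u\varphi' : \varphi\in C^1_c(\mathbb R),\ |\varphi|\le 1\}\in[0,+\infty]$ be the total variation (the norm of the homogeneous space $BV(\mathbb R)$). Let $a_1=0$, $a_{j+1}=a_j+\frac4j+j^2$, $I_j=[a_j,a_j+\frac4j]$ and $e_j=(-1)^j\frac{\sqrt j}{2}\chi_{I_j}$ for $j\ge 1$; this is an orthonormal system in $L^2(\mathbb R)$. Let $\tilde H$ be its closed linear span. Given $M\ge 2$, an integer $k\ge 3$, $c_0>0$, $b>0$ and $0<\delta<1/k$, put $A_1=1-k\delta$, $A_i=\delta$ for $2\le i\le k-1$, $A_k=2\delta$, $C_m=\sum_{i=1}^m A_i$ for $1\le m\le k$, and $\eta_j=\sqrt{c_0/M^j}$, $\mu_j=-\delta\eta_j$ for $j\ge1$. Define $\Lambda:L^2(\mathbb R)\to L^2(\mathbb R)$ by $$\Lambda(e_1)=\sum_{m=1}^k C_m\eta_m e_m+\sum_{m=k+1}^{\infty}\eta_m e_m+\mu_k e_k,$$ $$\Lambda(e_j)=\frac{\sqrt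 j}{b}\Big[\sum_{i=1}^k A_i\eta_{j+i-2}e_{j+i-2}+\mu_{j+k-2}e_{j+k-2}-\mu_{j+k-1}e_{j+k-1}\Big]\quad(j\ge 2),$$ $\Lambda\big(\sum_j\gamma_je_j\big)=\sum_j\gamma_j\Lambda(e_j)$ for $\gamma\in\ell_2$, and $\Lambda(w)=w$ for $w\in\tilde H^\perp$. Let $\sigma_n=\sum_{j=0}^n\frac{b}{\sqrt{j+2}}\,e_{j+2}$ for $n\ge 0$. Given a datum $f\in L^2(\mathbb R)$ and parameters $\lambda_n>0$, a *multiscale sequence* is a sequence of partial sums $s_n=\sum_{j=0}^n u_j$ such that, for every $n\ge0$, $u_n$ minimizes $\lambda_n\|f-\Lambda(s_{n-1}+u)\|_{L^2}^2+\|u\|_{BV(\mathbb R)}$ over $u\in L^2(\mathbb R)$, where $s_{-1}=0$. **Theorem.** 1. For all $M\ge2$, $k\ge3$, $c_0>0$, $b>0$, $0<\delta<1/k$, the operator $\Lambda$ is well defined, linear, bounded and injective on $L^2(\mathbb R)$, and for all $f,s\in L^2(\mathbb R)$ and $\lambda>0$ the problem $\min\{\lambda\|f-\Lambda(s+u)\|_{L^2}^2+\|u\|_{BV(\mathbb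 R)}: u\in L^2(\mathbb R)\}$ has exactly one solution. 2. For every $b>0$ and $n\ge0$, $\|\sigma_n\|_{L^2}^2=b^2\sum_{j=2}^{n+2}\frac1j$, $\|\sigma_n\|_{L^1}=2b\sum_{j=2}^{n+2}\frac1j$ and $\|\sigma_n\|_{BV(\mathbb R)}=b(n+1)$. So all three norms tend to $+\infty$ as $n\to\infty$, and no subsequence of $(\sigma_n)$ converges in $L^2(\mathbb R)$. 3. Let $k=5$. For any $M\ge2$ and $\alpha_0>0$ there exist $c_0>0$, $b>0$ and $0<\delta<1/5$ such that $(\sigma_n)_{n\ge0}$ is the one and only multiscale sequence for the datum $f=\Lambda(e_1)$ and the parameters $\lambda_n=\alpha_0M^n$. Hence, for this operator and the datum $\Lambda(e_1)$, the $BV$-$L^2$ multiscale decomposition does not converge in the unknowns space. -/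

import Mathlib

open MeasureTheory Filter Topology
open scoped ENNReal InnerProductSpace

namespace MultiscaleBlur

/-- The real Hilbert space `L²(ℝ)` with Lebesgue measure. -/
abbrev L2 : Type := Lp ℝ 2 (volume : Measure ℝ)

/-- Test functions for the total variation: `C¹`, compactly supported, with values in `[-1, 1]`. -/
def IsTest (φ : ℝ → ℝ) : Prop :=
  ContDiff ℝ 1 φ ∧ HasCompactSupport φ ∧ ∀ x, |φ x| ≤ 1

/-- The total variation `|Du|(ℝ) = sup { ∫ u φ' : φ ∈ C¹_c(ℝ), |φ| ≤ 1 }` of `u ∈ L²(ℝ)`, which is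
`⊤` when the distributional derivative of `u` is not a finite measure. This is the norm of the
homogeneous space `BV(ℝ)`: an `L²` function of finite total variation vanishes at `±∞`, so the
condition at infinity in the definition of `BV(ℝ)` holds by itself on `L²(ℝ)`. -/
noncomputable def TV (u : L2) : ℝ≥0∞ :=
  ⨆ (φ : ℝ → ℝ) (_ : IsTest φ), ENNReal.ofReal (∫ x, u x * deriv φ x)

/-! The multiscale procedure in `L²(ℝ)`, with exponents `2` (fidelity) and `1` (regularization). -/

/-- The functional `u ↦ lam ‖f - Λ (σ + u)‖² + |Du|(ℝ)`. -/
noncomputable def functional (Λ : L2 → L2) (f : L2) (lam : ℝ) (σ u : L2) : ℝ≥0∞ :=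
  ENNReal.ofReal (lam * ‖f - Λ (σ + u)‖ ^ 2) + TV u

/-- `u` minimizes `lam ‖f - Λ (σ + u)‖² + |Du|(ℝ)` over `L²(ℝ)`. -/
def IsMinimizer (Λ : L2 → L2) (f : L2) (lam : ℝ) (σ u : L2) : Prop :=
  ∀ w : L2, functional Λ f lam σ u ≤ functional Λ f lam σ w

/-- `σ` is a multiscale sequence for the datum `f` and the parameters `lam n`: it is the sequence of
partial sums of some `(u n)`, where `u n` solves the `n`-th problem with offset
`u 0 + ⋯ + u (n - 1)` (which is `0` for `n = 0`). -/
def IsMultiscaleSeq (Λ : L2 → L2) (f : L2) (lam : ℕ → ℝ) (σ : ℕ → L2) : Prop :=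
  ∃ u : ℕ → L2,
    (∀ n, IsMinimizer Λ f (lam n) (∑ j ∈ Finset.range n, u j) (u n)) ∧
    ∀ n, σ n = ∑ j ∈ Finset.range (n + 1), u j

/-! The orthonormal system. The index `j` is meant to be at least `1`. -/

/-- Left end points: `a 1 = 0` and `a (j + 1) = a j + 4 / j + j ^ 2`. -/
noncomputable def a (j : ℕ) : ℝ := ∑ i ∈ Finset.Ico 1 j, (4 / (i : ℝ) + (i : ℝ) ^ 2)

/-- The interval `I_j = [a_j, a_j + 4 / j]`. -/
def I (j : ℕ) : Set ℝ := Set.Icc (a j) (a j + 4 / (j : ℝ))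

theorem measurableSet_I (j : ℕ) : MeasurableSet (I j) := measurableSet_Icc

theorem volume_I_ne_top (j : ℕ) : (volume : Measure ℝ) (I j) ≠ ⊤ :=
  isCompact_Icc.measure_lt_top.ne

/-- `e_j = (-1)^j (√j / 2) χ_{I_j}`. -/
noncomputable def e (j : ℕ) : L2 :=
  indicatorConstLp 2 (measurableSet_I j) (volume_I_ne_top j) ((-1) ^ j * (Real.sqrt j / 2))

/-- The closed linear span of `e_1, e_2, …`. -/
noncomputable def Htilde : Submodule ℝ L2 :=
  (Submodule.span ℝ (Set.range fun j : ℕ => e (j + 1))).topologicalClosure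

noncomputable instance : Htilde.HasOrthogonalProjection :=
  haveI : CompleteSpace Htilde :=
    (Submodule.isClosed_topologicalClosure _).completeSpace_coe
  inferInstance

/-! The blurring operator. -/

/-- `A_1 = 1 - k δ`, `A_i = δ` for `2 ≤ i ≤ k - 1`, `A_k = 2 δ` (only `1 ≤ i ≤ k` is used). -/
noncomputable def A (k : ℕ) (δ : ℝ) (i : ℕ) : ℝ :=
  if i = 1 then 1 - k * δ else if i = k then 2 * δ else δ

/-- `C_m = A_1 + ⋯ + A_m` (only `1 ≤ m ≤ k` is used). -/
noncomputable def C (k : ℕ) (δ : ℝ) (m : ℕ) : ℝ := ∑ i ∈ Finset.Icc 1 m, A k δ i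

/-- `η_j = √(c₀ / M^j)`. -/
noncomputable def η (M c₀ : ℝ) (j : ℕ) : ℝ := Real.sqrt (c₀ / M ^ j)

/-- `μ_j = - δ η_j`. -/
noncomputable def μ (M c₀ δ : ℝ) (j : ℕ) : ℝ := -δ * η M c₀ j

/-- The image of `e_1`. -/
noncomputable def image₁ (M : ℝ) (k : ℕ) (c₀ δ : ℝ) : L2 :=
  (∑ m ∈ Finset.Icc 1 k, (C k δ m * η M c₀ m) • e m)
    + (∑' m : ℕ, η M c₀ (k + 1 + m) • e (k + 1 + m))
    + μ M c₀ δ k • e k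

/-- The image of `e_j` for `j ≥ 2`. -/
noncomputable def image₂ (M : ℝ) (k : ℕ) (c₀ b δ : ℝ) (j : ℕ) : L2 :=
  (Real.sqrt j / b) •
    ((∑ i ∈ Finset.Icc 1 k, (A k δ i * η M c₀ (j + i - 2)) • e (j + i - 2))
      + μ M c₀ δ (j + k - 2) • e (j + k - 2)
      - μ M c₀ δ (j + k - 1) • e (j + k - 1))

/-- The prescribed image of `e_j`, `j ≥ 1`. -/
noncomputable def image (M : ℝ) (k : ℕ) (c₀ b δ : ℝ) (j : ℕ) : L2 :=
  if j = 1 then image₁ M k c₀ δ else image₂ M k c₀ b δ j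

/-- The blurring operator: `Σ γ_j e_j ↦ Σ γ_j image_j` on `Htilde`, and the identity on the
orthogonal complement of `Htilde`. -/
noncomputable def Λ (M : ℝ) (k : ℕ) (c₀ b δ : ℝ) (w : L2) : L2 :=
  (∑' j : ℕ, ⟪e (j + 1), w⟫_ℝ • image M k c₀ b δ (j + 1)) + (w - Htilde.starProjection w)

/-- `σ_n = Σ_{j = 0}^n (b / √(j + 2)) e_{j + 2}`. -/
noncomputable def σ (b : ℝ) (n : ℕ) : L2 :=
  ∑ j ∈ Finset.range (n + 1), (b / Real.sqrt ((j : ℝ) + 2)) • e (j + 2)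

end MultiscaleBlur

/-!
The total variation of `u` is a supremum of integrals against derivatives of test functions, and
it may also be tested with piecewise affine functions
(`ofReal_integral_le_TV_of_lipschitz`). For finitely many consecutive intervals this says that
`∑ d_i mean_i(u) ≤ |Du|(ℝ)` as soon as, up to a constant, the partial sums of the weights `d_i`
stay in `[-1, 1]` (`ofReal_sum_mean_le_TV`). Three facts rest on this inequality.

* *Lower bounds.* The primitive of `∑ √j e_j` alternates between `-1` and `1`, which gives the
  total variation of `σ n`.

* *Coercivity.* `Λ` acts on `Htilde` as a compact operator, so `‖Λ w‖` alone does not control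
  `‖w‖`. But it controls the component of `w` orthogonal to `Htilde`, hence the means of `w` over
  the gaps between the intervals `I_j`. These gaps have length `j ^ 2`, so the means are at most
  `‖Λ w‖ / j`, and the sum over `j` of the differences to the means over `I_j` is at most the total
  variation (`exists_norm_le`). The sublevel sets of the functional are therefore bounded, closed
  and convex, and minimizers exist (`exists_isMinimizer`). They are unique because `Λ` is injective:
  the coefficients of `Λ w` in `e_1, e_2, …` form a triangular system, whose only candidates for a
  kernel are multiples of a sequence that decays like `1 / √j` (`eq_zero_of_Λ_eq_zero`).

* *Optimality.* With `B` as below, `Λ e_1 = ∑ (B_1 + ⋯ + B_m) η_m e_m`, and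
  `Λ (b / √j e_j) = ∑ B_i η_{j + i - 2} e_{j + i - 2}`. So subtracting `Λ (σ n)` from `Λ e_1` only
  shifts the coefficients by `n + 1` indices (`inner_e_residual`), and the parameters `α₀ M ^ n`
  compensate the decay of `η`. The function `p = 2 α₀ M ^ n Λ* (Λ e_1 - Λ (σ n))` is a combination
  of `e_1, e_2, …`, and its primitive jumps by `2 (-1)^j D_j` over `I_j`, where `D_2, D_3, …`
  increases up to `D_{n + 2} = 1` and decreases from there on, if `k = 5` and `δ = 11 / 60`. If `c₀`
  is small then so is `D_1`, and the estimate for alternating series keeps the primitive in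
  `[-1, 1]`, while over `I_{n + 2}` it moves from one end of this interval to the other
  (`exists_const_abs_add_sum_le`). Hence `p` is a subgradient of the total variation at
  `b / √(n + 2) e_{n + 2}`, which is thus the `n`-th minimizer (`isMinimizer_smul_e`).
-/

namespace MultiscaleBlur

/-! ### Testing the total variation with Lipschitz functions -/

theorem IsTest.memLp_deriv {φ : ℝ → ℝ} (hφ : IsTest φ) : MemLp (deriv φ) 2 volume :=
  (hφ.1.continuous_deriv le_rfl).memLp_of_hasCompactSupport hφ.2.1.deriv

theorem IsTest.zero : IsTest (fun _ => 0) :=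
  ⟨contDiff_const, HasCompactSupport.zero, fun x => by simp⟩

theorem integral_mul_eq_inner (u : L2) {g : ℝ → ℝ} (hg : MemLp g 2 volume) :
    ∫ x, u x * g x = ⟪hg.toLp g, u⟫_ℝ := by
  rw [L2.inner_def]
  refine integral_congr_ae ?_
  filter_upwards [hg.coeFn_toLp] with x hx
  simp [hx]

theorem ofReal_integral_le_TV {φ : ℝ → ℝ} (hφ : IsTest φ) (u : L2) :
    ENNReal.ofReal (∫ x, u x * deriv φ x) ≤ TV u :=
  le_iSup₂ (f := fun (φ : ℝ → ℝ) (_ : IsTest φ) => ENNReal.ofReal (∫ x, u x * deriv φ x)) φ hφ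

theorem locallyIntegrable_L2 (u : L2) : LocallyIntegrable (fun x => u x) volume :=
  (Lp.memLp u).locallyIntegrable (by norm_num)

/-- The total variation may be tested with Lipschitz functions. The means of `Φ` over
`[x, x + h]` are admissible test functions, and their derivatives, the difference quotients
of `Φ`, converge to `Φ'` boundedly and almost everywhere. -/
theorem ofReal_integral_le_TV_of_lipschitz {Φ ψ : ℝ → ℝ} {K : NNReal} (hL : LipschitzWith K Φ)
    (hs : HasCompactSupport Φ) (hb : ∀ x, |Φ x| ≤ 1) (hd : ∀ᵐ x, HasDerivAt Φ (ψ x) x) (u : L2) :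
    ENNReal.ofReal (∫ x, u x * ψ x) ≤ TV u := by
  obtain ⟨R, hR⟩ : ∃ R : ℝ, ∀ x, R < |x| → Φ x = 0 := by
    obtain ⟨R, hR⟩ := hs.isCompact.isBounded.subset_closedBall 0
    refine ⟨R, fun x hx => ?_⟩
    by_contra h
    have := hR (subset_tsupport _ h)
    simp at this
    linarith
  have hc : Continuous Φ := hL.continuous
  let h : ℕ → ℝ := fun n => 1 / ((n : ℝ) + 1)
  have h0 : ∀ n, 0 < h n := fun n => by positivity
  have h1 : ∀ n, h n ≤ 1 := fun n => by
    simp only [h]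
    rw [div_le_one (by positivity)]
    linarith [n.cast_nonneg (α := ℝ)]
  let P : ℝ → ℝ := fun x => ∫ t in (0 : ℝ)..x, Φ t
  have hP : ∀ x, HasDerivAt P (Φ x) x := fun x =>
    intervalIntegral.integral_hasDerivAt_right (hc.intervalIntegrable _ _)
      hc.aestronglyMeasurable.stronglyMeasurableAtFilter hc.continuousAt
  let φ : ℕ → ℝ → ℝ := fun n x => (h n)⁻¹ * (P (x + h n) - P x)
  have hφ' : ∀ n x, HasDerivAt (φ n) ((h n)⁻¹ * (Φ (x + h n) - Φ x)) x := fun n x =>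
    (((hP (x + h n)).comp_add_const x (h n)).sub (hP x)).const_mul _
  have hderiv : ∀ n, deriv (φ n) = fun x => (h n)⁻¹ * (Φ (x + h n) - Φ x) := fun n =>
    funext fun x => (hφ' n x).deriv
  have hφeq : ∀ n x, φ n x = (h n)⁻¹ * ∫ t in x..(x + h n), Φ t := fun n x => by
    simp only [φ, P]
    rw [intervalIntegral.integral_interval_sub_left (hc.intervalIntegrable _ _)
      (hc.intervalIntegrable _ _)]
  have htest : ∀ n, IsTest (φ n) := by
    intro n
    refine ⟨?_, ?_, fun x => ?_⟩
    · rw [contDiff_one_iff_deriv, hderiv]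
      exact ⟨fun x => (hφ' n x).differentiableAt, by fun_prop⟩
    · refine HasCompactSupport.intro (isCompact_Icc (a := -R - 1) (b := R)) fun x hx => ?_
      rw [hφeq, intervalIntegral.integral_zero_ae, mul_zero]
      refine Eventually.of_forall fun t ht => hR t ?_
      rw [Set.uIoc_of_le (by linarith [h0 n])] at ht
      by_contra hlt
      rw [not_lt, abs_le] at hlt
      exact hx ⟨by linarith [ht.2, h1 n], by linarith [ht.1]⟩
    · rw [hφeq, abs_mul, abs_of_pos (inv_pos.2 (h0 n)), inv_mul_le_iff₀ (h0 n)]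
      have := intervalIntegral.norm_integral_le_of_norm_le_const (a := x) (b := x + h n) (C := 1)
        (f := Φ) fun t _ => hb t
      simpa [abs_of_pos (h0 n)] using this
  have hlim : Tendsto (fun n => ∫ x, u x * deriv (φ n) x) atTop (𝓝 (∫ x, u x * ψ x)) := by
    refine tendsto_integral_of_dominated_convergence
      ((Set.Icc (-R - 1) R).indicator fun x => K * ‖u x‖) (fun n => ?_) ?_ (fun n => ?_) ?_
    · exact (Lp.aestronglyMeasurable u).mul
        ((htest n).1.continuous_deriv le_rfl).aestronglyMeasurable
    · rw [integrable_indicator_iff measurableSet_Icc]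
      exact (((locallyIntegrable_L2 u).integrableOn_isCompact isCompact_Icc).norm).const_mul _
    · refine Eventually.of_forall fun x => ?_
      rw [hderiv]
      by_cases hx : x ∈ Set.Icc (-R - 1) R
      · rw [Set.indicator_of_mem hx, norm_mul, mul_comm]
        refine mul_le_mul_of_nonneg_right ?_ (norm_nonneg _)
        rw [norm_mul, norm_inv, Real.norm_of_nonneg (h0 n).le, inv_mul_le_iff₀ (h0 n), mul_comm]
        simpa [Real.norm_of_nonneg (h0 n).le, dist_eq_norm, abs_of_pos (h0 n)]
          using hL.dist_le_mul (x + h n) x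
      · rw [Set.indicator_of_notMem hx]
        have e1 : Φ x = 0 := hR x (by
          by_contra hlt; rw [not_lt, abs_le] at hlt
          exact hx ⟨by linarith [hlt.1], hlt.2⟩)
        have e2 : Φ (x + h n) = 0 := hR _ (by
          by_contra hlt; rw [not_lt, abs_le] at hlt
          exact hx ⟨by linarith [hlt.1, h1 n], by linarith [hlt.2, h0 n]⟩)
        simp [e1, e2]
    · filter_upwards [hd] with x hx
      refine Tendsto.const_mul _ ?_
      have hh : Tendsto h atTop (𝓝[≠] 0) :=
        tendsto_nhdsWithin_iff.2 ⟨tendsto_one_div_add_atTop_nhds_zero_nat,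
          Eventually.of_forall fun n => (h0 n).ne'⟩
      simpa [hderiv, Function.comp_def] using (hasDerivAt_iff_tendsto_slope_zero.1 hx).comp hh
  exact le_of_tendsto (ENNReal.tendsto_ofReal hlim)
    (Eventually.of_forall fun n => ofReal_integral_le_TV (htest n) u)

/-! ### Piecewise affine test functions and mean values on intervals -/

/-- The continuous function that vanishes on `(-∞, α]`, equals `1` on `[β, ∞)`, and is affine
in between. -/
noncomputable def ramp (α β x : ℝ) : ℝ := max 0 (min 1 ((x - α) / (β - α)))

/-- The mean value of `u` over `[α, β]`. -/
noncomputable def mean (α β : ℝ) (u : L2) : ℝ := (β - α)⁻¹ * ∫ x in Set.Icc α β, u x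

theorem ramp_of_le {α β x : ℝ} (h : α < β) (hx : x ≤ α) : ramp α β x = 0 := by
  unfold ramp
  refine max_eq_left ((min_le_right _ _).trans ?_)
  exact div_nonpos_of_nonpos_of_nonneg (by linarith) (by linarith)

theorem ramp_of_ge {α β x : ℝ} (h : α < β) (hx : β ≤ x) : ramp α β x = 1 := by
  unfold ramp
  have : 1 ≤ (x - α) / (β - α) := by rw [le_div_iff₀ (by linarith)]; linarith
  rw [min_eq_left this, max_eq_right zero_le_one]

theorem ramp_nonneg (α β x : ℝ) : 0 ≤ ramp α β x := le_max_left _ _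

theorem ramp_le_one (α β x : ℝ) : ramp α β x ≤ 1 := max_le zero_le_one (min_le_left _ _)

theorem exists_lipschitz_ramp (α β : ℝ) : ∃ K, LipschitzWith K (ramp α β) := by
  have h1 : LipschitzWith (Real.nnabs (β - α)⁻¹) fun x : ℝ => (x - α) / (β - α) := by
    refine LipschitzWith.of_dist_le_mul fun x y => ?_
    rw [Real.dist_eq, Real.dist_eq, ← sub_div, div_eq_inv_mul, abs_mul]
    simp
  exact ⟨_, (h1.const_min 1).const_max 0⟩

theorem ae_hasDerivAt_ramp {α β : ℝ} (h : α < β) :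
    ∀ᵐ x, HasDerivAt (ramp α β) ((Set.Icc α β).indicator (fun _ => (β - α)⁻¹) x) x := by
  have h0 : ∀ y : ℝ, ∀ᵐ x : ℝ, x ≠ y := fun y => by simp [ae_iff]
  filter_upwards [h0 α, h0 β] with x hα hβ
  rcases lt_or_gt_of_ne hα with h1 | h1
  · rw [Set.indicator_of_notMem (fun hx => absurd hx.1 (not_le.2 h1))]
    refine (hasDerivAt_const x (0 : ℝ)).congr_of_eventuallyEq ?_
    filter_upwards [Iio_mem_nhds h1] with y hy using ramp_of_le h (le_of_lt hy)
  · rcases lt_or_gt_of_ne hβ with h2 | h2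
    · rw [Set.indicator_of_mem (Set.mem_Icc.2 ⟨h1.le, h2.le⟩)]
      have : HasDerivAt (fun y : ℝ => (y - α) / (β - α)) ((β - α)⁻¹) x := by
        simpa using ((hasDerivAt_id x).sub_const α).div_const (β - α)
      refine this.congr_of_eventuallyEq ?_
      filter_upwards [Ioo_mem_nhds h1 h2] with y hy
      have e1 : (y - α) / (β - α) ≤ 1 := by rw [div_le_one (by linarith)]; linarith [hy.2]
      have e2 : 0 ≤ (y - α) / (β - α) := div_nonneg (by linarith [hy.1]) (by linarith)
      rw [ramp, min_eq_right e1, max_eq_right e2]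
    · rw [Set.indicator_of_notMem (fun hx => absurd hx.2 (not_le.2 h2))]
      refine (hasDerivAt_const x (1 : ℝ)).congr_of_eventuallyEq ?_
      filter_upwards [Ioi_mem_nhds h2] with y hy using ramp_of_ge h (le_of_lt hy)

theorem mul_indicator_eq (u : L2) (α β : ℝ) :
    (fun x => u x * (Set.Icc α β).indicator (fun _ => (β - α)⁻¹) x)
      = (Set.Icc α β).indicator fun x => (β - α)⁻¹ * u x := by
  funext x
  by_cases hx : x ∈ Set.Icc α β <;> simp [hx, mul_comm]

theorem integrable_mul_indicator (u : L2) (α β : ℝ) :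
    Integrable fun x => u x * (Set.Icc α β).indicator (fun _ => (β - α)⁻¹) x := by
  rw [mul_indicator_eq, integrable_indicator_iff measurableSet_Icc]
  exact ((locallyIntegrable_L2 u).integrableOn_isCompact isCompact_Icc).const_mul _

theorem integral_mul_indicator (u : L2) (α β : ℝ) :
    ∫ x, u x * (Set.Icc α β).indicator (fun _ => (β - α)⁻¹) x = mean α β u := by
  rw [mul_indicator_eq, integral_indicator measurableSet_Icc, integral_const_mul, mean]

theorem abs_setIntegral_le {α β : ℝ} (h : α ≤ β) (u : L2) :
    |∫ x in Set.Icc α β, u x| ≤ Real.sqrt (β - α) * ‖u‖ := by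
  have h1 := L2.inner_indicatorConstLp_one (𝕜 := ℝ) (measurableSet_Icc (a := α) (b := β))
    isCompact_Icc.measure_lt_top.ne u
  rw [← h1]
  refine (abs_real_inner_le_norm _ _).trans (le_of_eq ?_)
  rw [norm_indicatorConstLp (by norm_num) (by norm_num)]
  simp [Measure.real, ENNReal.toReal_ofReal (sub_nonneg.2 h), Real.sqrt_eq_rpow]

theorem abs_mean_le {α β : ℝ} (h : α < β) (u : L2) :
    |mean α β u| ≤ (Real.sqrt (β - α))⁻¹ * ‖u‖ := by
  have h0 : 0 < β - α := sub_pos.2 h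
  rw [mean, abs_mul, abs_of_pos (inv_pos.2 h0)]
  calc _ ≤ (β - α)⁻¹ * (Real.sqrt (β - α) * ‖u‖) :=
        mul_le_mul_of_nonneg_left (abs_setIntegral_le h.le u) (inv_pos.2 h0).le
    _ = _ := by
        have h2 := Real.sqrt_pos.2 h0
        nth_rw 1 [← Real.mul_self_sqrt h0.le]
        field_simp

/-- At every point at most one ramp takes a value other than `0` and `1`, so the function lies
between two consecutive partial sums of its jumps. -/
theorem abs_add_sum_ramp_le {α β d : ℕ → ℝ} (hαβ : ∀ i, α i < β i) (hβα : ∀ i, β i ≤ α (i + 1))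
    {c : ℝ} {n : ℕ} (hc : ∀ m ≤ n, |c + ∑ i ∈ Finset.range m, d i| ≤ 1) (x : ℝ) :
    |c + ∑ i ∈ Finset.range n, d i * ramp (α i) (β i) x| ≤ 1 := by
  induction n with
  | zero => simpa using hc 0 le_rfl
  | succ n ih =>
    have ih := ih fun m hm => hc m (hm.trans n.le_succ)
    rcases le_total x (α n) with hx | hx
    · simpa [Finset.sum_range_succ, ramp_of_le (hαβ n) hx] using ih
    · have hmono : Monotone α := monotone_nat_of_le_succ fun i => (hαβ i).le.trans (hβα i)
      have h1 : ∀ i ∈ Finset.range n, d i * ramp (α i) (β i) x = d i := fun i hi => by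
        rw [ramp_of_ge (hαβ i), mul_one]
        exact (hβα i).trans ((hmono (Finset.mem_range.1 hi)).trans hx)
      rw [Finset.sum_range_succ, Finset.sum_congr rfl h1]
      have h2 := abs_le.1 (hc n n.le_succ)
      have h3 := abs_le.1 (hc (n + 1) le_rfl)
      rw [Finset.sum_range_succ] at h3
      have r0 := ramp_nonneg (α n) (β n) x
      have r1 := ramp_le_one (α n) (β n) x
      rw [abs_le]
      constructor <;> nlinarith

theorem lipschitzWith_const_mul (c : ℝ) {K : NNReal} {f : ℝ → ℝ} (hf : LipschitzWith K f) :
    LipschitzWith (‖c‖₊ * K) fun x => c * f x :=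
  (lipschitzWith_smul c).comp hf

theorem exists_lipschitz_sum_ramp (α β d : ℕ → ℝ) (n : ℕ) :
    ∃ K, LipschitzWith K fun x => ∑ i ∈ Finset.range n, d i * ramp (α i) (β i) x := by
  induction n with
  | zero => exact ⟨0, by simp⟩
  | succ n ih =>
    obtain ⟨K, hK⟩ := ih
    obtain ⟨K', hK'⟩ := exists_lipschitz_ramp (α n) (β n)
    simp only [Finset.sum_range_succ]
    exact ⟨_, hK.add (lipschitzWith_const_mul (d n) hK')⟩

/-- A weighted sum of means of `u` over consecutive intervals is at most the total variation of
`u` when, up to a constant `c`, the partial sums of the weights stay in `[-1, 1]`: test with the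
piecewise affine function that starts at `c` and changes by `d i` over the `i`-th interval. -/
theorem ofReal_sum_mean_le_TV {α β d : ℕ → ℝ} (hαβ : ∀ i, α i < β i) (hβα : ∀ i, β i ≤ α (i + 1))
    {c : ℝ} {n : ℕ} (hc : ∀ m ≤ n, |c + ∑ i ∈ Finset.range m, d i| ≤ 1) (u : L2) :
    ENNReal.ofReal (∑ i ∈ Finset.range n, d i * mean (α i) (β i) u) ≤ TV u := by
  set S : ℝ := c + ∑ i ∈ Finset.range n, d i with hS
  have hmono : Monotone α := monotone_nat_of_le_succ fun i => (hαβ i).le.trans (hβα i)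
  -- Long outer ramps on `[α 0 - R, α 0]` and `[α n, α n + R]` make the test function compactly
  -- supported; the means of `u` over them tend to zero as `R → ∞`.
  have key : ∀ R : ℝ, 0 < R → ENNReal.ofReal (c * mean (α 0 - R) (α 0) u
      + ∑ i ∈ Finset.range n, d i * mean (α i) (β i) u - S * mean (α n) (α n + R) u) ≤ TV u := by
    intro R hR
    let Φ : ℝ → ℝ := fun x => c * ramp (α 0 - R) (α 0) x
      + ∑ i ∈ Finset.range n, d i * ramp (α i) (β i) x - S * ramp (α n) (α n + R) x
    have hR0 : α 0 - R < α 0 := by linarith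
    have hRn : α n < α n + R := by linarith
    have hsum0 : ∀ x ≤ α 0, ∑ i ∈ Finset.range n, d i * ramp (α i) (β i) x = 0 := fun x hx =>
      Finset.sum_eq_zero fun i _ => by
        rw [ramp_of_le (hαβ i) (hx.trans (hmono i.zero_le)), mul_zero]
    have hsum1 : ∀ x, α n ≤ x →
        ∑ i ∈ Finset.range n, d i * ramp (α i) (β i) x = ∑ i ∈ Finset.range n, d i := fun x hx =>
      Finset.sum_congr rfl fun i hi => by
        rw [ramp_of_ge (hαβ i) ((hβα i).trans ((hmono (Finset.mem_range.1 hi)).trans hx)), mul_one]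
    obtain ⟨K₁, hK₁⟩ := exists_lipschitz_ramp (α 0 - R) (α 0)
    obtain ⟨K₂, hK₂⟩ := exists_lipschitz_sum_ramp α β d n
    obtain ⟨K₃, hK₃⟩ := exists_lipschitz_ramp (α n) (α n + R)
    have hL := ((lipschitzWith_const_mul c hK₁).add hK₂).sub (lipschitzWith_const_mul S hK₃)
    have hsupp : HasCompactSupport Φ := by
      refine HasCompactSupport.intro (isCompact_Icc (a := α 0 - R) (b := α n + R)) fun x hx => ?_
      rcases lt_or_ge x (α 0 - R) with h | h
      · simp only [Φ]
        rw [ramp_of_le hR0 h.le, hsum0 x (by linarith),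
          ramp_of_le hRn (by linarith [hmono n.zero_le])]
        ring
      · have h' : α n + R < x := by
          by_contra h2
          exact hx ⟨h, not_lt.1 h2⟩
        simp only [Φ]
        rw [ramp_of_ge hR0 (by linarith [hmono n.zero_le]), hsum1 x (by linarith),
          ramp_of_ge hRn h'.le]
        ring
    have hc0 : |c| ≤ 1 := by simpa using hc 0 n.zero_le
    have hcn : |S| ≤ 1 := hc n le_rfl
    have hbound : ∀ x, |Φ x| ≤ 1 := by
      intro x
      rcases le_total x (α 0) with h | h
      · have : Φ x = c * ramp (α 0 - R) (α 0) x := by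
          simp only [Φ]
          rw [hsum0 x h, ramp_of_le hRn (h.trans (hmono n.zero_le))]
          ring
        rw [this, abs_mul, abs_of_nonneg (ramp_nonneg _ _ _)]
        exact mul_le_one₀ hc0 (ramp_nonneg _ _ _) (ramp_le_one _ _ _)
      · rcases le_total x (α n) with h' | h'
        · have : Φ x = c + ∑ i ∈ Finset.range n, d i * ramp (α i) (β i) x := by
            simp only [Φ]
            rw [ramp_of_ge hR0 h, ramp_of_le hRn h']
            ring
          rw [this]
          exact abs_add_sum_ramp_le hαβ hβα hc x
        · have : Φ x = S * (1 - ramp (α n) (α n + R) x) := by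
            simp only [Φ]
            rw [ramp_of_ge hR0 h, hsum1 x h']
            ring
          have r0 := ramp_nonneg (α n) (α n + R) x
          have r1 := ramp_le_one (α n) (α n + R) x
          rw [this, abs_mul, abs_of_nonneg (sub_nonneg.2 r1)]
          exact mul_le_one₀ hcn (by linarith) (by linarith)
    have hderiv : ∀ᵐ x, HasDerivAt Φ
        (c * (Set.Icc (α 0 - R) (α 0)).indicator (fun _ => (α 0 - (α 0 - R))⁻¹) x
        + ∑ i ∈ Finset.range n, d i * (Set.Icc (α i) (β i)).indicator (fun _ => (β i - α i)⁻¹) x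
        - S * (Set.Icc (α n) (α n + R)).indicator (fun _ => (α n + R - α n)⁻¹) x) x := by
      filter_upwards [ae_hasDerivAt_ramp hR0, ae_hasDerivAt_ramp hRn,
        ae_all_iff.2 fun i => ae_hasDerivAt_ramp (hαβ i)] with x h1 h2 h3
      exact ((h1.const_mul c).add
        (HasDerivAt.fun_sum fun i _ => (h3 i).const_mul (d i))).sub (h2.const_mul S)
    have := ofReal_integral_le_TV_of_lipschitz hL hsupp hbound hderiv u
    convert this using 2
    have hi : ∀ (r p q x : ℝ), u x * (r * (Set.Icc p q).indicator (fun _ => (q - p)⁻¹) x)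
        = r * (u x * (Set.Icc p q).indicator (fun _ => (q - p)⁻¹) x) := fun r p q x => by ring
    simp only [mul_sub, mul_add, Finset.mul_sum, hi]
    rw [integral_sub, integral_add, integral_finsetSum]
    · simp only [integral_const_mul, integral_mul_indicator]
    · exact fun i _ => (integrable_mul_indicator u _ _).const_mul _
    · exact (integrable_mul_indicator u _ _).const_mul _
    · exact integrable_finsetSum _ fun i _ => (integrable_mul_indicator u _ _).const_mul _
    · exact ((integrable_mul_indicator u _ _).const_mul _).add
        (integrable_finsetSum _ fun i _ => (integrable_mul_indicator u _ _).const_mul _)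
    · exact (integrable_mul_indicator u _ _).const_mul _
  have hz : Tendsto (fun R : ℝ => (Real.sqrt R)⁻¹ * ‖u‖) atTop (𝓝 0) := by
    simpa using (tendsto_inv_atTop_zero.comp Real.tendsto_sqrt_atTop).mul_const ‖u‖
  have hz1 : Tendsto (fun R : ℝ => mean (α 0 - R) (α 0) u) atTop (𝓝 0) := by
    refine squeeze_zero_norm' ?_ hz
    filter_upwards [eventually_gt_atTop 0] with R hR
    simpa using abs_mean_le (show α 0 - R < α 0 by linarith) u
  have hz2 : Tendsto (fun R : ℝ => mean (α n) (α n + R) u) atTop (𝓝 0) := by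
    refine squeeze_zero_norm' ?_ hz
    filter_upwards [eventually_gt_atTop 0] with R hR
    simpa using abs_mean_le (show α n < α n + R by linarith) u
  have hlim := (((hz1.const_mul c).add_const (∑ i ∈ Finset.range n, d i * mean (α i) (β i) u)).sub
    (hz2.const_mul S))
  simp only [mul_zero, zero_add, sub_zero] at hlim
  refine le_of_tendsto (ENNReal.tendsto_ofReal hlim) ?_
  filter_upwards [eventually_gt_atTop 0] with R hR using key R hR

/-! ### The orthonormal system -/

theorem a_succ (j : ℕ) : a (j + 1) = a j + 4 / (j : ℝ) + (j : ℝ) ^ 2 := by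
  rcases Nat.eq_zero_or_pos j with rfl | hj
  · simp [a]
  · rw [a, Finset.sum_Ico_succ_top hj, a, add_assoc]

theorem a_add_le (j : ℕ) : a j + 4 / (j : ℝ) ≤ a (j + 1) := by
  rw [a_succ]
  linarith [sq_nonneg (j : ℝ)]

theorem a_mono : Monotone a := monotone_nat_of_le_succ fun j =>
  le_trans (le_add_of_nonneg_right (by positivity)) (a_add_le j)

theorem notMem_I_of_lt {i j : ℕ} (hi : 1 ≤ i) (hij : i < j) {x : ℝ} (hx : x ∈ I i) : x ∉ I j := by
  intro hx'
  have h1 : a (i + 1) ≤ a j := a_mono hij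
  have h2 : (0 : ℝ) < (i : ℝ) ^ 2 := by positivity
  rw [a_succ] at h1
  linarith [hx.2, hx'.1]

theorem eq_of_mem_I {i j : ℕ} (hi : 1 ≤ i) (hj : 1 ≤ j) {x : ℝ} (hx : x ∈ I i) (hx' : x ∈ I j) :
    i = j := by
  rcases lt_trichotomy i j with h | h | h
  · exact absurd hx' (notMem_I_of_lt hi h hx)
  · exact h
  · exact absurd hx (notMem_I_of_lt hj h hx')

theorem volume_real_I (j : ℕ) : (volume : Measure ℝ).real (I j) = 4 / (j : ℝ) := by
  rw [I, Measure.real, Real.volume_Icc, add_sub_cancel_left, ENNReal.toReal_ofReal (by positivity)]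

theorem inner_e_e {i j : ℕ} (hi : 1 ≤ i) (hj : 1 ≤ j) :
    ⟪e i, e j⟫_ℝ = if i = j then 1 else 0 := by
  rw [e, e, L2.inner_indicatorConstLp_indicatorConstLp (measurableSet_I i) (measurableSet_I j)
    (volume_I_ne_top i) (volume_I_ne_top j)]
  split_ifs with h
  · subst h
    have h0 : (0 : ℝ) < i := by exact_mod_cast hi
    have h1 : ((-1 : ℝ) ^ i) * (-1) ^ i = 1 := by rw [← mul_pow]; simp
    have h2 : Real.sqrt i * Real.sqrt i = i := Real.mul_self_sqrt h0.le
    rw [Set.inter_self, volume_real_I]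
    simp only [RCLike.inner_apply, conj_trivial, smul_eq_mul]
    calc _ = (4 / (i : ℝ)) * (((-1 : ℝ) ^ i * (-1) ^ i) * ((Real.sqrt i * Real.sqrt i) / 4)) := by
          ring
      _ = 1 := by rw [h1, h2]; field_simp
  · have : I i ∩ I j = ∅ := 
      Set.eq_empty_of_forall_notMem fun x hx => h (eq_of_mem_I hi hj hx.1 hx.2)
    simp [this]

theorem orthonormal_e : Orthonormal ℝ fun j : ℕ => e (j + 1) := by
  rw [orthonormal_iff_ite]
  intro i j
  simpa using inner_e_e (Nat.succ_pos i) (Nat.succ_pos j)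

theorem norm_e {j : ℕ} (hj : 1 ≤ j) : ‖e j‖ = 1 := by
  obtain ⟨i, rfl⟩ := Nat.exists_eq_add_of_le' hj
  exact orthonormal_e.1 i

theorem inner_e (j : ℕ) (w : L2) :
    ⟪e j, w⟫_ℝ = (-1) ^ j * (Real.sqrt j / 2) * ∫ x in I j, w x := by
  rw [e, L2.inner_indicatorConstLp_eq_inner_setIntegral ℝ (measurableSet_I j)]
  simp [mul_comm]

theorem inner_e_eq_mean {j : ℕ} (hj : 1 ≤ j) (w : L2) :
    ⟪e j, w⟫_ℝ = (-1) ^ j * (2 / Real.sqrt j) * mean (a j) (a j + 4 / (j : ℝ)) w := by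
  have h0 : (0 : ℝ) < j := by exact_mod_cast hj
  have h1 : 0 < Real.sqrt j := Real.sqrt_pos.2 h0
  have h2 : (j : ℝ) = Real.sqrt j * Real.sqrt j := (Real.mul_self_sqrt h0.le).symm
  have h3 : Real.sqrt j / 2 = 2 / Real.sqrt j * (j / 4) := by
    field_simp
    linarith
  rw [inner_e, mean, h3, add_sub_cancel_left, inv_div, I]
  ring

/-- If the primitive of `∑ q_j e_j`, which changes by `2 (-1)^j q_j / √j` over `I_j`, can be chosen
with values in `[-1, 1]`, then `∑ q_j e_j` belongs to the subdifferential of the total variation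
at the origin. -/
theorem ofReal_sum_inner_e_le_TV {q : ℕ → ℝ} {c : ℝ} {n : ℕ}
    (hc : ∀ m ≤ n, |c + ∑ i ∈ Finset.range m,
      2 * (-1) ^ (i + 1) * (q (i + 1) / Real.sqrt ((i + 1 : ℕ) : ℝ))| ≤ 1) (w : L2) :
    ENNReal.ofReal (∑ i ∈ Finset.range n, q (i + 1) * ⟪e (i + 1), w⟫_ℝ) ≤ TV w := by
  have := ofReal_sum_mean_le_TV (α := fun i => a (i + 1))
    (β := fun i => a (i + 1) + 4 / ((i + 1 : ℕ) : ℝ))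
    (fun i => lt_add_of_pos_right _ (by positivity)) (fun i => a_add_le (i + 1)) hc w
  convert this using 3 with i
  rw [inner_e_eq_mean (Nat.le_add_left 1 i)]
  ring

theorem inner_toLp_deriv_le_TV {φ : ℝ → ℝ} (hφ : IsTest φ) (u : L2) :
    ENNReal.ofReal ⟪hφ.memLp_deriv.toLp (deriv φ), u⟫_ℝ ≤ TV u := by
  rw [← integral_mul_eq_inner]
  exact ofReal_integral_le_TV hφ u

theorem TV_le {u : L2} {c : ℝ≥0∞}
    (h : ∀ (φ : ℝ → ℝ) (hφ : IsTest φ),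
      ENNReal.ofReal ⟪hφ.memLp_deriv.toLp (deriv φ), u⟫_ℝ ≤ c) : TV u ≤ c :=
  iSup₂_le fun φ hφ => by
    rw [integral_mul_eq_inner u hφ.memLp_deriv]
    exact h φ hφ

theorem abs_inner_toLp_deriv_e_le {φ : ℝ → ℝ} (hφ : IsTest φ) (j : ℕ) :
    |⟪hφ.memLp_deriv.toLp (deriv φ), e j⟫_ℝ| ≤ Real.sqrt j := by
  have h1 : ∫ x in I j, (hφ.memLp_deriv.toLp (deriv φ) : L2) x
      = φ (a j + 4 / (j : ℝ)) - φ (a j) := by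
    rw [setIntegral_congr_ae (g := deriv φ) (measurableSet_I j)
      (hφ.memLp_deriv.coeFn_toLp.mono fun x hx _ => hx), I, integral_Icc_eq_integral_Ioc,
      ← intervalIntegral.integral_of_le (le_add_of_nonneg_right (by positivity))]
    exact intervalIntegral.integral_deriv_eq_sub
      (fun x _ => (hφ.1.differentiable one_ne_zero) x)
      ((hφ.1.continuous_deriv le_rfl).intervalIntegrable _ _)
  rw [real_inner_comm, inner_e, h1, abs_mul, abs_mul, abs_pow, abs_neg, abs_one, one_pow, one_mul,
    abs_of_nonneg (by positivity)]
  have h2 := abs_le.1 (hφ.2.2 (a j + 4 / (j : ℝ)))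
  have h3 := abs_le.1 (hφ.2.2 (a j))
  have h4 : |φ (a j + 4 / (j : ℝ)) - φ (a j)| ≤ 2 := by
    rw [abs_le]
    constructor <;> linarith
  nlinarith [Real.sqrt_nonneg j]

theorem TV_sum_smul_e_le (s : Finset ℕ) (c : ℕ → ℝ) (k : ℕ → ℕ) :
    TV (∑ j ∈ s, c j • e (k j)) ≤ ENNReal.ofReal (∑ j ∈ s, |c j| * Real.sqrt (k j)) := by
  refine TV_le fun φ hφ => ENNReal.ofReal_le_ofReal ?_
  rw [inner_sum]
  refine Finset.sum_le_sum fun j _ => ?_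
  rw [real_inner_smul_right]
  refine (le_abs_self _).trans ?_
  rw [abs_mul]
  exact mul_le_mul_of_nonneg_left (abs_inner_toLp_deriv_e_le hφ _) (abs_nonneg _)

/-! ### The norms of the partial sums -/

theorem sum_range_eq_sum_Icc (f : ℕ → ℝ) (n : ℕ) :
    ∑ j ∈ Finset.range (n + 1), f (j + 2) = ∑ j ∈ Finset.Icc 2 (n + 2), f j := by
  rw [Finset.range_eq_Ico, Finset.sum_Ico_add' f 0 (n + 1) 2]
  rfl

theorem inner_e_σ {b : ℝ} {m : ℕ} (hm : 1 ≤ m) (n : ℕ) :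
    ⟪e m, σ b n⟫_ℝ = ∑ j ∈ Finset.range (n + 1),
      (b / Real.sqrt ((j : ℝ) + 2)) * if m = j + 2 then 1 else 0 := by
  rw [σ, inner_sum]
  refine Finset.sum_congr rfl fun j _ => ?_
  rw [real_inner_smul_right, inner_e_e hm (by omega)]

theorem inner_e_σ_of_le {b : ℝ} {j n : ℕ} (h : j ≤ n) :
    ⟪e (j + 2), σ b n⟫_ℝ = b / Real.sqrt ((j : ℝ) + 2) := by
  rw [inner_e_σ (by omega), Finset.sum_eq_single j]
  · simp
  · intro i _ hi
    simp [Ne.symm hi]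
  · intro hj
    exact absurd (Finset.mem_range.2 (by omega)) hj

theorem norm_σ_sq (b : ℝ) (n : ℕ) :
    ‖σ b n‖ ^ 2 = b ^ 2 * ∑ j ∈ Finset.Icc 2 (n + 2), 1 / (j : ℝ) := by
  rw [← real_inner_self_eq_norm_sq]
  nth_rw 1 [σ]
  rw [sum_inner, ← sum_range_eq_sum_Icc (fun j => 1 / (j : ℝ)), Finset.mul_sum]
  refine Finset.sum_congr rfl fun j hj => ?_
  rw [real_inner_smul_left, inner_e_σ_of_le (by have := Finset.mem_range.1 hj; omega)]
  have h0 : (0 : ℝ) ≤ (j : ℝ) + 2 := by positivity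
  rw [div_mul_div_comm, Real.mul_self_sqrt h0]
  push_cast
  ring

theorem enorm_sum_indicator (s : Finset ℕ) (c : ℕ → ℝ) (x : ℝ) :
    ‖∑ j ∈ s, (I (j + 2)).indicator (fun _ => c j) x‖ₑ
      = ∑ j ∈ s, (I (j + 2)).indicator (fun _ => ‖c j‖ₑ) x := by
  by_cases h : ∃ j ∈ s, x ∈ I (j + 2)
  · obtain ⟨j, hj, hx⟩ := h
    have h0 : ∀ i ∈ s, i ≠ j → x ∉ I (i + 2) := fun i _ hij hi =>
      hij (by have := eq_of_mem_I (by omega) (by omega) hi hx; omega)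
    rw [Finset.sum_eq_single_of_mem j hj fun i hi hij => by simp [h0 i hi hij],
      Finset.sum_eq_single_of_mem j hj fun i hi hij => by simp [h0 i hi hij]]
    simp [hx]
  · push Not at h
    rw [Finset.sum_eq_zero fun j hj => by simp [h j hj],
      Finset.sum_eq_zero fun j hj => by simp [h j hj]]
    simp

theorem eLpNorm_one_σ {b : ℝ} (hb : 0 < b) (n : ℕ) :
    eLpNorm (σ b n) 1 volume
      = ENNReal.ofReal (2 * b * ∑ j ∈ Finset.Icc 2 (n + 2), 1 / (j : ℝ)) := by
  let c : ℕ → ℝ := fun j =>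
    b / Real.sqrt ((j : ℝ) + 2) * ((-1) ^ (j + 2) * (Real.sqrt ((j + 2 : ℕ) : ℝ) / 2))
  have hσ : (σ b n : ℝ → ℝ) =ᵐ[volume] fun x =>
      ∑ j ∈ Finset.range (n + 1), (I (j + 2)).indicator (fun _ => c j) x := by
    have h1 : ∀ j : ℕ, ∀ᵐ x, ((b / Real.sqrt ((j : ℝ) + 2)) • e (j + 2) : L2) x
        = (I (j + 2)).indicator (fun _ => c j) x := fun j => by
      filter_upwards [Lp.coeFn_smul (b / Real.sqrt ((j : ℝ) + 2)) (e (j + 2)),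
        indicatorConstLp_coeFn (p := 2) (hs := measurableSet_I (j + 2))
          (hμs := volume_I_ne_top (j + 2))
          (c := ((-1 : ℝ) ^ (j + 2) * (Real.sqrt ((j + 2 : ℕ) : ℝ) / 2)))] with x h2 h3
      rw [h2, Pi.smul_apply, e, h3]
      by_cases hx : x ∈ I (j + 2) <;> simp [hx, c]
    filter_upwards [Lp.coeFn_finsetSum (Finset.range (n + 1))
      (fun j : ℕ => (b / Real.sqrt ((j : ℝ) + 2)) • e (j + 2)), ae_all_iff.2 h1] with x h2 h3
    rw [σ, h2, Finset.sum_apply]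
    exact Finset.sum_congr rfl fun j _ => h3 j
  have hc : ∀ j : ℕ, ‖c j‖ₑ * volume (I (j + 2))
      = ENNReal.ofReal (2 * b * (1 / ((j + 2 : ℕ) : ℝ))) := by
    intro j
    have h0 : (0 : ℝ) < (j : ℝ) + 2 := by positivity
    have h1 : ‖c j‖ = b / 2 := by
      have h2 : 0 < Real.sqrt ((j : ℝ) + 2) := Real.sqrt_pos.2 h0
      simp only [c]
      rw [norm_mul, norm_mul, norm_pow, norm_neg, norm_one, one_pow, one_mul,
        Real.norm_of_nonneg (by positivity), Real.norm_of_nonneg (by positivity)]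
      push_cast
      field_simp
    rw [← ofReal_norm, h1, I, Real.volume_Icc, add_sub_cancel_left,
      ← ENNReal.ofReal_mul (by positivity)]
    congr 1
    push_cast
    ring
  rw [eLpNorm_one_eq_lintegral_enorm, lintegral_congr_ae (g := fun x =>
    ∑ j ∈ Finset.range (n + 1), (I (j + 2)).indicator (fun _ => ‖c j‖ₑ) x)]
  · rw [lintegral_finsetSum _ fun j _ => measurable_const.indicator (measurableSet_I (j + 2)),
      ← sum_range_eq_sum_Icc (fun j => 1 / (j : ℝ)), Finset.mul_sum,
      ENNReal.ofReal_sum_of_nonneg fun j _ => by positivity]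
    refine Finset.sum_congr rfl fun j _ => ?_
    rw [lintegral_indicator_const (measurableSet_I (j + 2)), hc]
  · filter_upwards [hσ] with x hx
    rw [hx, enorm_sum_indicator]

theorem sum_range_two_mul_neg_one_pow (m : ℕ) :
    ∑ i ∈ Finset.range m, (2 * (-1) ^ (i + 1) : ℝ) = (-1) ^ m - 1 := by
  induction m with
  | zero => simp
  | succ m ih => rw [Finset.sum_range_succ, ih]; ring

theorem sum_range_sqrt_mul_inner_σ (b : ℝ) (n : ℕ) :
    ∑ j ∈ Finset.range (n + 1), Real.sqrt ((j : ℝ) + 2) * ⟪e (j + 2), σ b n⟫_ℝ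
      = b * ((n : ℝ) + 1) := by
  have : ∀ j ∈ Finset.range (n + 1),
      Real.sqrt ((j : ℝ) + 2) * ⟪e (j + 2), σ b n⟫_ℝ = b := fun j hj => by
    rw [inner_e_σ_of_le (by have := Finset.mem_range.1 hj; omega)]
    have h2 : 0 < Real.sqrt ((j : ℝ) + 2) := Real.sqrt_pos.2 (by positivity)
    field_simp
  rw [Finset.sum_congr rfl this]
  simp [mul_comm]

theorem TV_σ {b : ℝ} (hb : 0 < b) (n : ℕ) :
    TV (σ b n) = ENNReal.ofReal (b * ((n : ℝ) + 1)) := by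
  refine le_antisymm ?_ ?_
  · refine (TV_sum_smul_e_le _ _ _).trans (ENNReal.ofReal_le_ofReal (le_of_eq ?_))
    rw [Finset.sum_congr rfl (g := fun _ => b)]
    · simp [mul_comm]
    · intro j _
      have h2 : 0 < Real.sqrt ((j : ℝ) + 2) := Real.sqrt_pos.2 (by positivity)
      rw [abs_of_nonneg (by positivity)]
      push_cast
      field_simp
  · -- The primitive of `∑ √j e_j` alternates between `-1` and `1`, so the bound is attained.
    let q : ℕ → ℝ := fun j => if j = 1 then 0 else Real.sqrt j
    have hq : ∀ m ≤ n + 2, |(-1 : ℝ) + ∑ i ∈ Finset.range m,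
        2 * (-1) ^ (i + 1) * (q (i + 1) / Real.sqrt ((i + 1 : ℕ) : ℝ))| ≤ 1 := by
      intro m _
      rcases m with _ | m
      · simp
      · rw [Finset.sum_range_succ']
        have : ∀ i ∈ Finset.range m, (2 * (-1) ^ (i + 1 + 1)
            * (q (i + 1 + 1) / Real.sqrt ((i + 1 + 1 : ℕ) : ℝ)) : ℝ)
            = (-1) * (2 * (-1) ^ (i + 1)) := fun i _ => by
          have h2 : Real.sqrt ((i + 1 + 1 : ℕ) : ℝ) ≠ 0 := (Real.sqrt_pos.2 (by positivity)).ne'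
          have h3 : q (i + 1 + 1) = Real.sqrt ((i + 1 + 1 : ℕ) : ℝ) := by simp [q]
          rw [h3, div_self h2]
          ring
        rw [Finset.sum_congr rfl this, ← Finset.mul_sum, sum_range_two_mul_neg_one_pow]
        have : (-1 : ℝ) + (-1 * ((-1) ^ m - 1) + 2 * (-1) ^ (0 + 1)
            * (q (0 + 1) / Real.sqrt ((0 + 1 : ℕ) : ℝ))) = -(-1) ^ m := by
          simp [q]
          ring
        rw [this, abs_neg, abs_pow]
        simp
    have := ofReal_sum_inner_e_le_TV hq (σ b n)
    rw [Finset.sum_range_succ'] at this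
    rw [← sum_range_sqrt_mul_inner_σ]
    refine (le_of_eq (congrArg _ ?_)).trans this
    have h1 : q (0 + 1) = 0 := by simp [q]
    rw [h1, zero_mul, add_zero]
    refine Finset.sum_congr rfl fun j _ => ?_
    have h3 : q (j + 1 + 1) = Real.sqrt ((j : ℝ) + 2) := by
      simp only [q]
      rw [if_neg (by omega)]
      push_cast
      congr 1
      ring
    rw [h3]

theorem tendsto_sum_Icc_one_div :
    Tendsto (fun n : ℕ => ∑ j ∈ Finset.Icc 2 (n + 2), 1 / (j : ℝ)) atTop atTop := by
  have h := (tendsto_add_atTop_iff_nat 2).2 Real.tendsto_sum_range_one_div_nat_succ_atTop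
  refine (tendsto_atTop_add_const_right _ (-1 : ℝ) h).congr fun n => ?_
  rw [← sum_range_eq_sum_Icc, Finset.sum_range_succ']
  push_cast
  simp only [add_assoc]
  norm_num

theorem tendsto_norm_σ {b : ℝ} (hb : 0 < b) : Tendsto (fun n : ℕ => ‖σ b n‖) atTop atTop := by
  have h1 : ∀ n,
      ‖σ b n‖ = Real.sqrt (b ^ 2 * ∑ j ∈ Finset.Icc 2 (n + 2), 1 / (j : ℝ)) := fun n => by
    rw [← norm_σ_sq, Real.sqrt_sq (norm_nonneg _)]
  simp only [h1]
  exact Real.tendsto_sqrt_atTop.comp (tendsto_sum_Icc_one_div.const_mul_atTop (by positivity))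

theorem tendsto_eLpNorm_one_σ {b : ℝ} (hb : 0 < b) :
    Tendsto (fun n : ℕ => eLpNorm (σ b n) 1 volume) atTop (𝓝 ⊤) := by
  simp only [eLpNorm_one_σ hb]
  exact ENNReal.tendsto_ofReal_nhds_top.2
    (tendsto_sum_Icc_one_div.const_mul_atTop (by positivity))

theorem tendsto_TV_σ {b : ℝ} (hb : 0 < b) : Tendsto (fun n : ℕ => TV (σ b n)) atTop (𝓝 ⊤) := by
  simp only [TV_σ hb]
  exact ENNReal.tendsto_ofReal_nhds_top.2 ((tendsto_atTop_add_const_right _ (1 : ℝ)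
    tendsto_natCast_atTop_atTop).const_mul_atTop hb)

theorem not_tendsto_σ_comp {b : ℝ} (hb : 0 < b) {p : ℕ → ℕ} (hp : StrictMono p) (l : L2) :
    ¬ Tendsto (fun n : ℕ => σ b (p n)) atTop (𝓝 l) := fun h =>
  not_tendsto_nhds_of_tendsto_atTop ((tendsto_norm_σ hb).comp hp.tendsto_atTop) _ h.norm

/-! ### Expansions in the orthonormal system -/

theorem hasSum_of_forall_eq {X : Type*} [AddCommMonoid X] [TopologicalSpace X] {f g : ℕ → X} {x : X}
    (hg : HasSum g x) (hfg : ∀ j, f j = g j) : HasSum f x := by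
  rwa [show f = g from funext hfg]

theorem e_mem_Htilde {j : ℕ} (hj : 1 ≤ j) : e j ∈ Htilde := by
  obtain ⟨i, rfl⟩ := Nat.exists_eq_add_of_le' hj
  exact Submodule.le_topologicalClosure _ (Submodule.subset_span ⟨i, rfl⟩)

theorem mem_Htilde_of_hasSum {f : ℕ → L2} {w : L2} (h : HasSum f w) (hf : ∀ j, f j ∈ Htilde) :
    w ∈ Htilde :=
  (Submodule.isClosed_topologicalClosure _).mem_of_tendsto h
    (Eventually.of_forall fun _ => Htilde.sum_mem fun j _ => hf j)

theorem mem_Htilde_orthogonal_iff {w : L2} :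
    w ∈ Htildeᗮ ↔ ∀ j : ℕ, ⟪e (j + 1), w⟫_ℝ = 0 := by
  refine ⟨fun h j => h _ (e_mem_Htilde (Nat.succ_pos j)), fun h => ?_⟩
  rw [Htilde, Submodule.orthogonal_closure]
  have : Submodule.span ℝ (Set.range fun j : ℕ => e (j + 1)) ≤ (ℝ ∙ w)ᗮ := by
    rw [Submodule.span_le]
    rintro _ ⟨j, rfl⟩
    exact Submodule.mem_orthogonal_singleton_iff_inner_left.2 (h j)
  intro v hv
  exact Submodule.mem_orthogonal_singleton_iff_inner_left.1 (this hv)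

theorem inner_e_starProjection {j : ℕ} (hj : 1 ≤ j) (w : L2) :
    ⟪e j, Htilde.starProjection w⟫_ℝ = ⟪e j, w⟫_ℝ := by
  rw [← Submodule.inner_starProjection_left_eq_right,
    Submodule.starProjection_eq_self_iff.2 (e_mem_Htilde hj)]

theorem hasSum_starProjection (w : L2) :
    HasSum (fun j : ℕ => ⟪e (j + 1), w⟫_ℝ • e (j + 1)) (Htilde.starProjection w) := by
  have hs : Summable fun j : ℕ => ⟪e (j + 1), w⟫_ℝ • e (j + 1) := by
    have := (orthonormal_e.orthogonalFamily.summable_iff_norm_sq_summable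
      (fun j : ℕ => ⟪e (j + 1), w⟫_ℝ)).2 (orthonormal_e.inner_products_summable w)
    simpa using this
  have hmem := mem_Htilde_of_hasSum hs.hasSum
    fun j => Htilde.smul_mem _ (e_mem_Htilde (Nat.succ_pos j))
  rw [Submodule.eq_starProjection_of_mem_orthogonal hmem]
  · exact hs.hasSum
  · rw [mem_Htilde_orthogonal_iff]
    intro i
    have h1 := hs.hasSum.mapL (innerSL ℝ (e (i + 1)))
    have h2 : HasSum (fun j : ℕ => innerSL ℝ (e (i + 1)) (⟪e (j + 1), w⟫_ℝ • e (j + 1)))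
        ⟪e (i + 1), w⟫_ℝ := by
      refine hasSum_of_forall_eq (hasSum_ite_eq i ⟪e (i + 1), w⟫_ℝ) fun j => ?_
      rw [innerSL_apply_apply, real_inner_smul_right, inner_e_e (by omega) (by omega)]
      by_cases h : j = i
      · simp [h]
      · simp [h, Ne.symm h]
    rw [inner_sub_right, ← h1.unique h2, innerSL_apply_apply, sub_self]

theorem hasSum_sq_inner_e (w : L2) :
    HasSum (fun j : ℕ => ⟪e (j + 1), w⟫_ℝ ^ 2) (‖Htilde.starProjection w‖ ^ 2) := by
  have h := (hasSum_starProjection w).mapL (innerSL ℝ (Htilde.starProjection w))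
  rw [innerSL_apply_apply, real_inner_self_eq_norm_sq] at h
  refine hasSum_of_forall_eq h fun j => ?_
  rw [innerSL_apply_apply, real_inner_smul_right,
    real_inner_comm (e (j + 1)) (Htilde.starProjection w),
    inner_e_starProjection (Nat.succ_pos j), sq]

/-! ### The coefficients of the blurring operator -/

/-- The ranges of parameters for which the blurring operator is considered. -/
structure Admissible (M : ℝ) (k : ℕ) (c₀ b δ : ℝ) : Prop where
  two_le_M : 2 ≤ M
  three_le_k : 3 ≤ k
  c₀_pos : 0 < c₀
  b_pos : 0 < b
  δ_pos : 0 < δ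
  δ_lt : δ < 1 / (k : ℝ)

/-- The coefficients of `image₂` after absorbing the `μ`-terms into `A`:
`B_1 = 1 - k δ`, `B_i = δ` for `2 ≤ i ≤ k + 1`, and `B_i = 0` for all other `i`. The value
`B_0 = 0` allows for truncated subtraction in the index. -/
noncomputable def B (k : ℕ) (δ : ℝ) (i : ℕ) : ℝ :=
  if i = 0 then 0 else if i = 1 then 1 - k * δ else if i ≤ k + 1 then δ else 0

/-- The coefficients of `image₁`: `ρ_m = B_1 + ⋯ + B_m`, so `ρ_0 = 0` and `ρ_m = 1` for
`m ≥ k + 1`. -/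
noncomputable def ρ (k : ℕ) (δ : ℝ) (m : ℕ) : ℝ := ∑ i ∈ Finset.range (m + 1), B k δ i

variable {M : ℝ} {k : ℕ} {c₀ b δ : ℝ}

theorem Admissible.k_mul_lt (h : Admissible M k c₀ b δ) : k * δ < 1 := by
  have h0 : (0 : ℝ) < k := by exact_mod_cast (by have := h.three_le_k; omega : 0 < k)
  have := h.δ_lt
  rw [lt_div_iff₀ h0] at this
  linarith

theorem Admissible.M_pos (h : Admissible M k c₀ b δ) : 0 < M := by linarith [h.two_le_M]

theorem B_zero : B k δ 0 = 0 := by simp [B]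

theorem B_one : B k δ 1 = 1 - k * δ := by simp [B]

theorem B_of_le {i : ℕ} (hi : 2 ≤ i) (hik : i ≤ k + 1) : B k δ i = δ := by
  rw [B, if_neg (by omega), if_neg (by omega), if_pos hik]

theorem B_of_gt {i : ℕ} (hi : k + 1 < i) : B k δ i = 0 := by
  rw [B, if_neg (by omega), if_neg (by omega), if_neg (by omega)]

theorem B_nonneg (h : Admissible M k c₀ b δ) (i : ℕ) : 0 ≤ B k δ i := by
  have h1 := h.k_mul_lt
  have h2 := h.δ_pos
  unfold B
  split_ifs <;> linarith

theorem ρ_zero : ρ k δ 0 = 0 := by simp [ρ, B_zero]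

theorem ρ_succ (m : ℕ) : ρ k δ (m + 1) = ρ k δ m + B k δ (m + 1) := Finset.sum_range_succ _ _

theorem ρ_succ_of_le {m : ℕ} (hm : m ≤ k) : ρ k δ (m + 1) = 1 - k * δ + m * δ := by
  induction m with
  | zero => rw [ρ_succ, ρ_zero, B_one]; simp
  | succ m ih =>
    rw [ρ_succ, ih (by omega), B_of_le (by omega) (by omega)]
    push_cast
    ring

theorem ρ_of_ge {m : ℕ} (hm : k + 1 ≤ m) : ρ k δ m = 1 := by
  induction m, hm using Nat.le_induction with
  | base => rw [ρ_succ_of_le le_rfl]; ring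
  | succ m hm ih => rw [ρ_succ, ih, B_of_gt (by omega), add_zero]

theorem ρ_mono (h : Admissible M k c₀ b δ) : Monotone (ρ k δ) :=
  monotone_nat_of_le_succ fun m => by
    rw [ρ_succ]
    exact le_add_of_nonneg_right (B_nonneg h _)

theorem ρ_nonneg (h : Admissible M k c₀ b δ) (m : ℕ) : 0 ≤ ρ k δ m := by
  simpa [ρ_zero] using ρ_mono h m.zero_le

theorem ρ_le_one (h : Admissible M k c₀ b δ) (m : ℕ) : ρ k δ m ≤ 1 := by
  rw [← ρ_of_ge (k := k) (δ := δ) (le_max_right m (k + 1))]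
  exact ρ_mono h (le_max_left _ _)

theorem sum_range_B_sub (m : ℕ) : ∑ j ∈ Finset.range m, B k δ (m - j) = ρ k δ m := by
  rw [ρ, Finset.sum_range_succ', B_zero, add_zero, ← Finset.sum_range_reflect]
  refine Finset.sum_congr rfl fun j hj => ?_
  congr 1
  have := Finset.mem_range.1 hj
  omega

theorem A_eq_B {i : ℕ} (hi : 1 ≤ i) (hik : i < k) : A k δ i = B k δ i := by
  rw [A]
  split_ifs with h1 h2
  · rw [h1, B_one]
  · omega
  · rw [B_of_le (by omega) (by omega)]

theorem A_self (hk : 2 ≤ k) : A k δ k = B k δ k + δ := by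
  rw [A, if_neg (by omega), if_pos rfl, B_of_le hk (by omega)]
  ring

theorem C_eq_ρ {m : ℕ} (hm : m < k) : C k δ m = ρ k δ m := by
  induction m with
  | zero => simp [C, ρ_zero]
  | succ m ih =>
    rw [C, Finset.sum_Icc_succ_top (by omega), ← C, ih (by omega), ρ_succ, A_eq_B (by omega) hm]

theorem C_self (hk : 2 ≤ k) : C k δ k = ρ k δ k + δ := by
  obtain ⟨l, rfl⟩ := Nat.exists_eq_add_of_le' (by omega : 1 ≤ k)
  rw [C, Finset.sum_Icc_succ_top (by omega), ← C, C_eq_ρ (by omega), ρ_succ, A_self hk, add_assoc]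

theorem η_nonneg (j : ℕ) : 0 ≤ η M c₀ j := Real.sqrt_nonneg _

theorem η_pos (h : Admissible M k c₀ b δ) (j : ℕ) : 0 < η M c₀ j :=
  Real.sqrt_pos.2 (div_pos h.c₀_pos (pow_pos h.M_pos j))

theorem η_sq (h : Admissible M k c₀ b δ) (j : ℕ) : η M c₀ j ^ 2 = c₀ * M⁻¹ ^ j := by
  rw [η, Real.sq_sqrt (div_nonneg h.c₀_pos.le (pow_pos h.M_pos j).le), inv_pow, div_eq_mul_inv]

theorem η_eq (h : Admissible M k c₀ b δ) (j : ℕ) :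
    η M c₀ j = Real.sqrt c₀ * (Real.sqrt M)⁻¹ ^ j := by
  have h1 : M ^ j = (Real.sqrt M ^ j) ^ 2 := by
    rw [← pow_mul, mul_comm, pow_mul, Real.sq_sqrt h.M_pos.le]
  rw [η, Real.sqrt_div h.c₀_pos.le, h1, Real.sqrt_sq (by positivity), inv_pow, div_eq_mul_inv]

theorem ratio_lt_one (h : Admissible M k c₀ b δ) : (Real.sqrt M)⁻¹ < 1 := by
  refine inv_lt_one_of_one_lt₀ ?_
  rw [Real.lt_sqrt zero_le_one]
  linarith [h.two_le_M]

theorem summable_η (h : Admissible M k c₀ b δ) : Summable (η M c₀) := by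
  have : η M c₀ = fun j => Real.sqrt c₀ * (Real.sqrt M)⁻¹ ^ j := funext (η_eq h)
  rw [this]
  exact (summable_geometric_of_lt_one (by positivity) (ratio_lt_one h)).mul_left _

theorem η_antitone (h : Admissible M k c₀ b δ) : Antitone (η M c₀) := fun i j hij => by
  rw [η_eq h, η_eq h]
  exact mul_le_mul_of_nonneg_left
    (pow_le_pow_of_le_one (by positivity) (ratio_lt_one h).le hij) (Real.sqrt_nonneg _)

theorem norm_smul_e (c : ℝ) {j : ℕ} (hj : 1 ≤ j) : ‖c • e j‖ = |c| := by
  rw [norm_smul, norm_e hj, mul_one, Real.norm_eq_abs]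

theorem summable_η_smul_e (h : Admissible M k c₀ b δ) :
    Summable fun m : ℕ => η M c₀ (k + 1 + m) • e (k + 1 + m) := by
  refine Summable.of_norm_bounded (g := fun m => η M c₀ (k + 1 + m))
    ((summable_η h).comp_injective (add_right_injective (k + 1))) fun m => ?_
  rw [norm_smul_e _ (by omega), abs_of_nonneg (η_nonneg _)]

theorem hasSum_image₁ (h : Admissible M k c₀ b δ) :
    HasSum (fun m : ℕ => (ρ k δ (m + 1) * η M c₀ (m + 1)) • e (m + 1)) (image₁ M k c₀ δ) := by
  have hs : Summable fun m : ℕ => (ρ k δ (m + 1) * η M c₀ (m + 1)) • e (m + 1) := by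
    refine Summable.of_norm_bounded (g := fun m => η M c₀ (m + 1))
      ((summable_η h).comp_injective (add_left_injective 1)) fun m => ?_
    rw [norm_smul_e _ (by omega), abs_of_nonneg (mul_nonneg (ρ_nonneg h _) (η_nonneg _))]
    exact mul_le_of_le_one_left (η_nonneg _) (ρ_le_one h _)
  convert hs.hasSum using 1
  rw [← hs.sum_add_tsum_nat_add k, image₁]
  have h1 : ∑' m : ℕ, η M c₀ (k + 1 + m) • e (k + 1 + m)
      = ∑' m : ℕ, (ρ k δ (m + k + 1) * η M c₀ (m + k + 1)) • e (m + k + 1) := by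
    refine tsum_congr fun m => ?_
    rw [ρ_of_ge (by omega), one_mul, show m + k + 1 = k + 1 + m by ring]
  rw [h1, add_right_comm]
  congr 1
  obtain ⟨l, rfl⟩ := Nat.exists_eq_add_of_le' (by have := h.three_le_k; omega : 1 ≤ k)
  rw [Finset.sum_Icc_succ_top (by omega), Finset.sum_range_succ, add_assoc]
  congr 1
  · rw [Finset.range_eq_Ico, Finset.sum_Ico_add'
      (fun m => (ρ (l + 1) δ m * η M c₀ m) • e m) 0 l 1]
    refine Finset.sum_congr rfl fun m hm => ?_
    rw [C_eq_ρ (by have := (Finset.mem_Icc.1 hm).2; omega)]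
  · rw [← add_smul, C_self (by have := h.three_le_k; omega), μ]
    congr 1
    ring

theorem image₂_eq (h : Admissible M k c₀ b δ) (j : ℕ) :
    image₂ M k c₀ b δ j = (Real.sqrt j / b) •
      ∑ i ∈ Finset.Icc 1 (k + 1), (B k δ i * η M c₀ (j + i - 2)) • e (j + i - 2) := by
  rw [image₂]
  congr 1
  have hk := h.three_le_k
  obtain ⟨l, rfl⟩ := Nat.exists_eq_add_of_le' (by omega : 1 ≤ k)
  rw [Finset.sum_Icc_succ_top (by omega), Finset.sum_Icc_succ_top (by omega),
    Finset.sum_Icc_succ_top (by omega), A_self (by omega),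
    B_of_le (i := l + 1 + 1) (by omega) le_rfl,
    Finset.sum_congr rfl fun i hi => by
      rw [A_eq_B (Finset.mem_Icc.1 hi).1 (by have := (Finset.mem_Icc.1 hi).2; omega)],
    show j + (l + 1 + 1) - 2 = j + (l + 1) - 1 by omega, μ, μ]
  module

theorem inner_e_image₁ (h : Admissible M k c₀ b δ) {m : ℕ} (hm : 1 ≤ m) :
    ⟪e m, image₁ M k c₀ δ⟫_ℝ = ρ k δ m * η M c₀ m := by
  obtain ⟨i, rfl⟩ := Nat.exists_eq_add_of_le' hm
  have h1 := (hasSum_image₁ h).mapL (innerSL ℝ (e (i + 1)))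
  refine h1.unique ?_
  refine hasSum_of_forall_eq (hasSum_ite_eq i (ρ k δ (i + 1) * η M c₀ (i + 1))) fun j => ?_
  rw [innerSL_apply_apply, real_inner_smul_right, inner_e_e (by omega) (by omega)]
  by_cases h : j = i
  · simp [h]
  · simp [h, Ne.symm h]

theorem inner_e_image₂ (h : Admissible M k c₀ b δ) {m j : ℕ} (hm : 1 ≤ m) (hj : 2 ≤ j) :
    ⟪e m, image₂ M k c₀ b δ j⟫_ℝ = Real.sqrt j / b * (B k δ (m + 2 - j) * η M c₀ m) := by
  rw [image₂_eq h, real_inner_smul_right, inner_sum]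
  congr 1
  rw [Finset.sum_congr rfl
    (g := fun i => if i = m + 2 - j then B k δ (m + 2 - j) * η M c₀ m else 0)]
  · rw [Finset.sum_ite_eq']
    split_ifs with hi
    · rfl
    · rcases Nat.eq_zero_or_pos (m + 2 - j) with h0 | h0
      · rw [h0, B_zero, zero_mul]
      · rw [B_of_gt (by by_contra hlt; exact hi (Finset.mem_Icc.2 ⟨h0, by omega⟩)), zero_mul]
  · intro i hi
    have hi := (Finset.mem_Icc.1 hi).1
    rw [real_inner_smul_right, inner_e_e hm (by omega)]
    split_ifs with h1 h2 h2
    · subst h2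
      rw [mul_one, ← h1]
    · omega
    · omega
    · rw [mul_zero]

theorem image_one : image M k c₀ b δ 1 = image₁ M k c₀ δ := by simp [image]

theorem image_of_two_le {j : ℕ} (hj : 2 ≤ j) :
    image M k c₀ b δ j = image₂ M k c₀ b δ j := by
  rw [image, if_neg (by omega)]

theorem image_mem_Htilde (h : Admissible M k c₀ b δ) {j : ℕ} (hj : 1 ≤ j) :
    image M k c₀ b δ j ∈ Htilde := by
  rcases hj.eq_or_lt with rfl | hj
  · rw [image_one]
    exact mem_Htilde_of_hasSum (hasSum_image₁ h)
      fun m => Htilde.smul_mem _ (e_mem_Htilde (Nat.succ_pos m))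
  · rw [image_of_two_le hj, image₂_eq h]
    refine Htilde.smul_mem _ (Htilde.sum_mem fun i hi => Htilde.smul_mem _ (e_mem_Htilde ?_))
    have := (Finset.mem_Icc.1 hi).1
    omega

theorem norm_image₂_le (h : Admissible M k c₀ b δ) {j : ℕ} (hj : 2 ≤ j) :
    ‖image₂ M k c₀ b δ j‖ ≤ Real.sqrt j / b * η M c₀ (j - 1) := by
  rw [image₂_eq h, norm_smul, Real.norm_of_nonneg (div_nonneg (Real.sqrt_nonneg _) h.b_pos.le)]
  refine mul_le_mul_of_nonneg_left ?_ (div_nonneg (Real.sqrt_nonneg _) h.b_pos.le)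
  have h1 : ∑ i ∈ Finset.Icc 1 (k + 1), B k δ i = 1 := by
    rw [← ρ_of_ge (k := k) (δ := δ) le_rfl, ρ, Finset.sum_range_eq_add_Ico _ (by omega), B_zero,
      zero_add]
    rfl
  rw [← one_mul (η M c₀ (j - 1)), ← h1, Finset.sum_mul]
  refine norm_sum_le_of_le _ fun i hi => ?_
  have hi := (Finset.mem_Icc.1 hi).1
  rw [norm_smul_e _ (by omega), abs_of_nonneg (mul_nonneg (B_nonneg h _) (η_nonneg _))]
  exact mul_le_mul_of_nonneg_left (η_antitone h (by omega)) (B_nonneg h _)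

theorem summable_norm_image (h : Admissible M k c₀ b δ) :
    Summable fun j : ℕ => ‖image M k c₀ b δ (j + 1)‖ := by
  rw [← summable_nat_add_iff 1]
  have hr := ratio_lt_one h
  have h0 : 0 ≤ (Real.sqrt M)⁻¹ := by positivity
  have hsum : Summable fun j : ℕ => ((j : ℝ) + 2) * (Real.sqrt M)⁻¹ ^ j := by
    have h1 := summable_pow_mul_geometric_of_norm_lt_one 1
      (r := (Real.sqrt M)⁻¹) (by rwa [Real.norm_of_nonneg h0])
    have h2 := (summable_geometric_of_lt_one h0 hr).mul_left 2
    refine (h1.add h2).congr fun j => ?_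
    ring
  refine Summable.of_nonneg_of_le (fun j => norm_nonneg _) (fun j => ?_)
    (hsum.mul_left (Real.sqrt c₀ / b))
  rw [image_of_two_le (by omega)]
  refine (norm_image₂_le h (by omega)).trans ?_
  have h3 : η M c₀ (j + 1 + 1 - 1) ≤ Real.sqrt c₀ * (Real.sqrt M)⁻¹ ^ j := by
    rw [← η_eq h]
    exact η_antitone h (by omega)
  have h4 : Real.sqrt ((j + 1 + 1 : ℕ) : ℝ) ≤ (j : ℝ) + 2 := by
    rw [Real.sqrt_le_iff]
    push_cast
    constructor <;> nlinarith [(j.cast_nonneg : (0 : ℝ) ≤ j)]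
  have hb := h.b_pos
  calc _ ≤ ((j : ℝ) + 2) / b * (Real.sqrt c₀ * (Real.sqrt M)⁻¹ ^ j) := by
        gcongr
        exact η_nonneg _
    _ = _ := by ring

/-! ### The blurring operator -/

/-- The blurring operator as a continuous linear map: a norm-convergent series of operators of
rank one on `Htilde`, plus the projection onto the orthogonal complement. -/
noncomputable def ΛL (M : ℝ) (k : ℕ) (c₀ b δ : ℝ) : L2 →L[ℝ] L2 :=
  (∑' j : ℕ, (innerSL ℝ (e (j + 1))).smulRight (image M k c₀ b δ (j + 1)))
    + (ContinuousLinearMap.id ℝ L2 - Htilde.starProjection)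

theorem summable_rankOne (h : Admissible M k c₀ b δ) :
    Summable fun j : ℕ => (innerSL ℝ (e (j + 1))).smulRight (image M k c₀ b δ (j + 1)) := by
  refine Summable.of_norm_bounded (summable_norm_image h) fun j => ?_
  rw [ContinuousLinearMap.norm_smulRight_apply, innerSL_apply_norm, norm_e (Nat.succ_pos j),
    one_mul]

theorem hasSum_inner_smul_image (h : Admissible M k c₀ b δ) (w : L2) :
    HasSum (fun j : ℕ => ⟪e (j + 1), w⟫_ℝ • image M k c₀ b δ (j + 1))
      ((∑' j : ℕ, (innerSL ℝ (e (j + 1))).smulRight (image M k c₀ b δ (j + 1))) w) := by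
  simpa using (summable_rankOne h).hasSum.mapL (ContinuousLinearMap.apply ℝ L2 w)

theorem ΛL_apply (h : Admissible M k c₀ b δ) (w : L2) : ΛL M k c₀ b δ w = Λ M k c₀ b δ w := by
  simp [ΛL, Λ, (hasSum_inner_smul_image h w).tsum_eq]

theorem hasSum_Λ (h : Admissible M k c₀ b δ) (w : L2) :
    HasSum (fun j : ℕ => ⟪e (j + 1), w⟫_ℝ • image M k c₀ b δ (j + 1))
      (Λ M k c₀ b δ w - (w - Htilde.starProjection w)) := by
  convert hasSum_inner_smul_image h w using 1
  rw [Λ, (hasSum_inner_smul_image h w).tsum_eq, add_sub_cancel_right]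

theorem Λ_e (h : Admissible M k c₀ b δ) (j : ℕ) :
    Λ M k c₀ b δ (e (j + 1)) = image M k c₀ b δ (j + 1) := by
  have h1 : HasSum (fun i : ℕ => ⟪e (i + 1), e (j + 1)⟫_ℝ • image M k c₀ b δ (i + 1))
      (image M k c₀ b δ (j + 1)) := by
    refine hasSum_of_forall_eq (hasSum_ite_eq j (image M k c₀ b δ (j + 1))) fun i => ?_
    rw [inner_e_e (by omega) (by omega)]
    by_cases hi : i = j
    · simp [hi]
    · simp [hi]
  have h2 := (hasSum_Λ h (e (j + 1))).unique h1
  rwa [Submodule.starProjection_eq_self_iff.2 (e_mem_Htilde (Nat.succ_pos j)), sub_self,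
    sub_zero] at h2

theorem Λ_of_mem_orthogonal {w : L2} (hw : w ∈ Htildeᗮ) : Λ M k c₀ b δ w = w := by
  have h1 := mem_Htilde_orthogonal_iff.1 hw
  rw [Λ, (Submodule.starProjection_apply_eq_zero_iff _).2 hw]
  simp [h1]

theorem Λ_sub_mem_Htilde (h : Admissible M k c₀ b δ) (w : L2) :
    Λ M k c₀ b δ w - (w - Htilde.starProjection w) ∈ Htilde :=
  mem_Htilde_of_hasSum (hasSum_Λ h w)
    fun j => Htilde.smul_mem _ (image_mem_Htilde h (Nat.succ_pos j))

/-- The blurring operator does not change the component orthogonal to `Htilde`. -/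
theorem starProjection_orthogonal_Λ (h : Admissible M k c₀ b δ) (w : L2) :
    Htildeᗮ.starProjection (Λ M k c₀ b δ w) = w - Htilde.starProjection w := by
  refine Submodule.eq_starProjection_of_mem_orthogonal
    (Submodule.sub_starProjection_mem_orthogonal w) ?_
  exact Submodule.le_orthogonal_orthogonal _ (Λ_sub_mem_Htilde h w)

theorem norm_sub_starProjection_le (h : Admissible M k c₀ b δ) (w : L2) :
    ‖w - Htilde.starProjection w‖ ≤ ‖Λ M k c₀ b δ w‖ := by
  rw [← starProjection_orthogonal_Λ h]
  exact Submodule.norm_starProjection_apply_le _ _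

theorem hasSum_inner_Λ (h : Admissible M k c₀ b δ) {r : L2} (hr : r ∈ Htilde) (w : L2) :
    HasSum (fun j : ℕ => ⟪e (j + 1), w⟫_ℝ * ⟪r, image M k c₀ b δ (j + 1)⟫_ℝ)
      ⟪r, Λ M k c₀ b δ w⟫_ℝ := by
  have h1 := (hasSum_Λ h w).mapL (innerSL ℝ r)
  rw [innerSL_apply_apply, inner_sub_right,
    Submodule.sub_starProjection_mem_orthogonal w r hr, sub_zero] at h1
  simpa [real_inner_smul_right] using h1

/-- If `Λ w = 0` then `w ∈ Htilde`, and comparing the coefficients of `e_1, e_2, …` in `Λ w`, which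
form a triangular system, gives `⟪e_j, w⟫ = -b ⟪e_1, w⟫ / √j` for `j ≥ 2`. As the harmonic series
diverges, this is square summable only if `⟪e_1, w⟫ = 0`. -/
theorem eq_zero_of_Λ_eq_zero (h : Admissible M k c₀ b δ) {w : L2} (hw : Λ M k c₀ b δ w = 0) :
    w = 0 := by
  have hb := h.b_pos
  let g : ℕ → ℝ := fun j => ⟪e (j + 2), w⟫_ℝ * (Real.sqrt ((j + 2 : ℕ) : ℝ) / b)
  have h1 : ∀ m, 1 ≤ m →
      ⟪e 1, w⟫_ℝ * ρ k δ m + ∑ j ∈ Finset.range m, g j * B k δ (m - j) = 0 := by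
    intro m hm
    have h2 := hasSum_inner_Λ h (e_mem_Htilde hm) w
    rw [hw, inner_zero_right] at h2
    have h3 := h2.unique (hasSum_sum_of_ne_finset_zero (s := Finset.range (m + 1)) fun j hj => by
      have hj : m + 1 ≤ j := by simpa using hj
      rw [image_of_two_le (by omega), inner_e_image₂ h hm (by omega),
        show m + 2 - (j + 1) = 0 by omega, B_zero]
      ring)
    rw [Finset.sum_range_succ', zero_add, image_one, inner_e_image₁ h hm] at h3
    have h4 : ∀ j ∈ Finset.range m, ⟪e (j + 1 + 1), w⟫_ℝ * ⟪e m, image M k c₀ b δ (j + 1 + 1)⟫_ℝ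
        = (g j * B k δ (m - j)) * η M c₀ m := fun j _ => by
      rw [image_of_two_le (by omega), inner_e_image₂ h hm (by omega),
        show m + 2 - (j + 1 + 1) = m - j by omega]
      simp only [g]
      ring
    rw [Finset.sum_congr rfl h4, ← Finset.sum_mul] at h3
    have h5 : (⟪e 1, w⟫_ℝ * ρ k δ m + ∑ j ∈ Finset.range m, g j * B k δ (m - j))
        * η M c₀ m = 0 := by
      linarith
    exact (mul_eq_zero.1 h5).resolve_right (η_pos h m).ne'
  have hg : ∀ j, g j = -⟪e 1, w⟫_ℝ := by
    intro j
    induction j using Nat.strong_induction_on with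
    | _ j ih =>
      have h2 := h1 (j + 1) (by omega)
      rw [← sum_range_B_sub, Finset.mul_sum, ← Finset.sum_add_distrib, Finset.sum_range_succ,
        Finset.sum_eq_zero fun i hi => by rw [ih i (Finset.mem_range.1 hi)]; ring, zero_add,
        ← add_mul, Nat.add_sub_cancel_left, B_one] at h2
      have h3 := (mul_eq_zero.1 h2).resolve_right (by linarith [h.k_mul_lt])
      linarith
  have hsq : ∀ j : ℕ, ⟪e (j + 2), w⟫_ℝ ^ 2
      = (⟪e 1, w⟫_ℝ ^ 2 * b ^ 2) * (1 / ((j + 2 : ℕ) : ℝ)) := by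
    intro j
    have h2 := hg j
    have h3 : 0 < Real.sqrt ((j + 2 : ℕ) : ℝ) := Real.sqrt_pos.2 (by positivity)
    have h4 : ⟪e (j + 2), w⟫_ℝ = -⟪e 1, w⟫_ℝ * b / Real.sqrt ((j + 2 : ℕ) : ℝ) := by
      rw [← h2]
      simp only [g]
      field_simp
    rw [h4, div_pow, Real.sq_sqrt (by positivity)]
    ring
  have he1 : ⟪e 1, w⟫_ℝ = 0 := by
    by_contra hne
    have h2 : Summable fun j : ℕ => ⟪e (j + 2), w⟫_ℝ ^ 2 :=
      (summable_nat_add_iff (f := fun j : ℕ => ⟪e (j + 1), w⟫_ℝ ^ 2) 1).2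
        (hasSum_sq_inner_e w).summable
    simp only [hsq] at h2
    rw [summable_mul_left_iff (by positivity),
      summable_nat_add_iff (f := fun j : ℕ => 1 / (j : ℝ)) 2] at h2
    exact Real.not_summable_one_div_natCast h2
  have horth : w ∈ Htildeᗮ := by
    rw [mem_Htilde_orthogonal_iff]
    rintro (_ | j)
    · exact he1
    · have h2 := hsq j
      rw [he1] at h2
      simpa using h2
  rw [← Λ_of_mem_orthogonal (M := M) (k := k) (c₀ := c₀) (b := b) (δ := δ) horth, hw]

theorem Λ_sub (h : Admissible M k c₀ b δ) (u v : L2) :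
    Λ M k c₀ b δ (u - v) = Λ M k c₀ b δ u - Λ M k c₀ b δ v := by
  simp only [← ΛL_apply h, map_sub]

theorem Λ_injective (h : Admissible M k c₀ b δ) : Function.Injective (Λ M k c₀ b δ) :=
  fun u v huv => sub_eq_zero.1 (eq_zero_of_Λ_eq_zero h (by rw [Λ_sub h, huv, sub_self]))

theorem hasSum_smul_Λ_e (h : Admissible M k c₀ b δ) {γ : ℕ → ℝ} {u : L2}
    (hu : HasSum (fun j : ℕ => γ (j + 1) • e (j + 1)) u) :
    HasSum (fun j : ℕ => γ (j + 1) • Λ M k c₀ b δ (e (j + 1))) (Λ M k c₀ b δ u) := by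
  rw [← ΛL_apply h]
  refine hasSum_of_forall_eq (hu.mapL (ΛL M k c₀ b δ)) fun j => ?_
  rw [map_smul, ΛL_apply h]

/-! ### Coercivity -/

theorem mean_eq_inner (α β : ℝ) (u : L2) :
    mean α β u = (β - α)⁻¹ * ⟪(indicatorConstLp 2 (measurableSet_Icc (a := α) (b := β))
      isCompact_Icc.measure_lt_top.ne (1 : ℝ) : L2), u⟫_ℝ := by
  rw [L2.inner_indicatorConstLp_one, mean]

theorem mean_gap_sub_starProjection (j : ℕ) (w : L2) :
    mean (a j + 4 / (j : ℝ)) (a (j + 1)) (w - Htilde.starProjection w)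
      = mean (a j + 4 / (j : ℝ)) (a (j + 1)) w := by
  rw [mean_eq_inner, mean_eq_inner, inner_sub_right]
  have horth : (indicatorConstLp 2
      (measurableSet_Icc (a := a j + 4 / (j : ℝ)) (b := a (j + 1)))
      isCompact_Icc.measure_lt_top.ne (1 : ℝ) : L2) ∈ Htildeᗮ := by
    rw [mem_Htilde_orthogonal_iff]
    intro i
    rw [e, L2.inner_indicatorConstLp_indicatorConstLp (measurableSet_I _) measurableSet_Icc
      (volume_I_ne_top _) isCompact_Icc.measure_lt_top.ne]
    have hsub : I (i + 1) ∩ Set.Icc (a j + 4 / (j : ℝ)) (a (j + 1))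
        ⊆ {a j + 4 / (j : ℝ), a (j + 1)} := by
      rintro x ⟨⟨h1, h2⟩, h3, h4⟩
      rcases lt_trichotomy (i + 1) j with hij | hij | hij
      · have h5 : a (i + 1 + 1) ≤ a j := a_mono hij
        have h6 : (0 : ℝ) ≤ 4 / (j : ℝ) := by positivity
        exact Or.inl (le_antisymm (by linarith [a_add_le (i + 1)]) h3)
      · subst hij
        exact Or.inl (le_antisymm h2 h3)
      · exact Or.inr (le_antisymm h4 ((a_mono hij).trans h1))
    have h0 : (volume : Measure ℝ).real
        (I (i + 1) ∩ Set.Icc (a j + 4 / (j : ℝ)) (a (j + 1))) = 0 := by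
      rw [Measure.real, measure_mono_null hsub ((Set.toFinite _).measure_zero _)]
      rfl
    rw [h0, zero_smul]
  rw [real_inner_comm (Htilde.starProjection w), horth _ (Submodule.starProjection_apply_mem _ w),
    sub_zero]

theorem abs_mean_gap_le {j : ℕ} (hj : 1 ≤ j) (w : L2) :
    |mean (a j + 4 / (j : ℝ)) (a (j + 1)) w| ≤ ‖w - Htilde.starProjection w‖ / j := by
  have h0 : (0 : ℝ) < j := by exact_mod_cast hj
  have h1 : a (j + 1) - (a j + 4 / (j : ℝ)) = (j : ℝ) ^ 2 := by rw [a_succ]; ring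
  rw [← mean_gap_sub_starProjection]
  refine (abs_mean_le (by rw [← sub_pos, h1]; positivity) _).trans (le_of_eq ?_)
  rw [h1, Real.sqrt_sq h0.le]
  ring

theorem sum_range_two_mul (f : ℕ → ℝ) (n : ℕ) :
    ∑ i ∈ Finset.range (2 * n), f i = ∑ i ∈ Finset.range n, (f (2 * i) + f (2 * i + 1)) := by
  induction n with
  | zero => simp
  | succ n ih =>
    rw [show 2 * (n + 1) = 2 * n + 1 + 1 by ring, Finset.sum_range_succ, Finset.sum_range_succ, ih,
      Finset.sum_range_succ]
    ring

/-- The total variation controls the sum of the differences between the mean over `I_j` and the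
mean over the gap between `I_j` and `I_{j + 1}`. -/
theorem ofReal_sum_abs_mean_sub_le_TV (n : ℕ) (w : L2) :
    ENNReal.ofReal (∑ i ∈ Finset.range n,
      |mean (a (i + 1)) (a (i + 1) + 4 / ((i + 1 : ℕ) : ℝ)) w
        - mean (a (i + 1) + 4 / ((i + 1 : ℕ) : ℝ)) (a (i + 1 + 1)) w|) ≤ TV w := by
  let t : ℕ → ℝ := fun i =>
    if i % 2 = 0 then a (i / 2 + 1) else a (i / 2 + 1) + 4 / ((i / 2 + 1 : ℕ) : ℝ)
  have t0 : ∀ i, t (2 * i) = a (i + 1) := fun i => by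
    simp only [t]
    rw [if_pos (by omega), show 2 * i / 2 = i by omega]
  have t1 : ∀ i, t (2 * i + 1) = a (i + 1) + 4 / ((i + 1 : ℕ) : ℝ) := fun i => by
    simp only [t]
    rw [if_neg (by omega), show (2 * i + 1) / 2 = i by omega]
  have t2 : ∀ i, t (2 * i + 1 + 1) = a (i + 1 + 1) := fun i => by
    rw [show 2 * i + 1 + 1 = 2 * (i + 1) by ring, t0]
  let ε : ℕ → ℝ := fun i =>
    if 0 ≤ mean (a (i + 1)) (a (i + 1) + 4 / ((i + 1 : ℕ) : ℝ)) w
      - mean (a (i + 1) + 4 / ((i + 1 : ℕ) : ℝ)) (a (i + 1 + 1)) w then 1 else -1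
  let d : ℕ → ℝ := fun i => if i % 2 = 0 then ε (i / 2) else -ε (i / 2)
  have d0 : ∀ i, d (2 * i) = ε i := fun i => by
    simp only [d]
    rw [if_pos (by omega), show 2 * i / 2 = i by omega]
  have d1 : ∀ i, d (2 * i + 1) = -ε i := fun i => by
    simp only [d]
    rw [if_neg (by omega), show (2 * i + 1) / 2 = i by omega]
  have hlt : ∀ i, t i < t (i + 1) := fun i => by
    rcases Nat.even_or_odd' i with ⟨r, rfl | rfl⟩
    · rw [t0, t1]
      exact lt_add_of_pos_right _ (by positivity)
    · rw [t1, t2, a_succ (r + 1)]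
      exact lt_add_of_pos_right _ (by positivity)
  have hd : ∀ m ≤ 2 * n, |(0 : ℝ) + ∑ i ∈ Finset.range m, d i| ≤ 1 := by
    intro m _
    have h0 : ∀ r, ∑ i ∈ Finset.range (2 * r), d i = 0 := fun r => by
      rw [sum_range_two_mul]
      exact Finset.sum_eq_zero fun i _ => by rw [d0, d1]; ring
    rcases Nat.even_or_odd' m with ⟨r, rfl | rfl⟩
    · rw [h0]
      simp
    · rw [Finset.sum_range_succ, h0, d0]
      simp only [ε]
      split_ifs <;> simp
  have := ofReal_sum_mean_le_TV hlt (fun i => le_refl (t (i + 1))) hd w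
  rw [sum_range_two_mul] at this
  convert this using 3 with i
  rw [d0, d1, t0, t1, t2]
  simp only [ε]
  split_ifs with h
  · rw [abs_of_nonneg h]
    ring
  · rw [abs_of_neg (not_le.1 h)]
    ring

theorem norm_sq_starProjection_le {w : L2} {V : ℝ} (hV : 0 ≤ V)
    (hTV : TV w ≤ ENNReal.ofReal V) :
    ‖Htilde.starProjection w‖ ^ 2
      ≤ 8 * ‖w - Htilde.starProjection w‖ ^ 2 * (∑' i : ℕ, 1 / ((i : ℝ) + 1) ^ 2) + 8 * V ^ 2 := by
  set R := ‖w - Htilde.starProjection w‖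
  let D : ℕ → ℝ := fun i => mean (a (i + 1)) (a (i + 1) + 4 / ((i + 1 : ℕ) : ℝ)) w
        - mean (a (i + 1) + 4 / ((i + 1 : ℕ) : ℝ)) (a (i + 1 + 1)) w
  have hs : Summable fun i : ℕ => 1 / ((i : ℝ) + 1) ^ 2 := by
    have := (summable_nat_add_iff (f := fun i : ℕ => 1 / (i : ℝ) ^ 2) 1).2
      (Real.summable_one_div_nat_pow.2 one_lt_two)
    simpa using this
  have hD : ∀ n, ∑ i ∈ Finset.range n, |D i| ≤ V := fun n =>
    (ENNReal.ofReal_le_ofReal_iff hV).1 ((ofReal_sum_abs_mean_sub_le_TV n w).trans hTV)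
  have hDi : ∀ i, |D i| ≤ V := fun i =>
    (Finset.single_le_sum (f := fun i => |D i|) (fun _ _ => abs_nonneg _)
      (Finset.self_mem_range_succ i)).trans (hD (i + 1))
  -- On `I_j` the squared coefficient is `4 / j` times the squared mean, and the mean differs by
  -- `D` from the mean over the neighbouring gap, which is at most `R / j`.
  have hterm : ∀ i : ℕ, ⟪e (i + 1), w⟫_ℝ ^ 2
      ≤ 8 * R ^ 2 * (1 / ((i : ℝ) + 1) ^ 2) + 8 * (V * |D i|) := by
    intro i
    have hi : (0 : ℝ) ≤ i := i.cast_nonneg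
    set m := mean (a (i + 1)) (a (i + 1) + 4 / ((i + 1 : ℕ) : ℝ)) w with hm
    set g := mean (a (i + 1) + 4 / ((i + 1 : ℕ) : ℝ)) (a (i + 1 + 1)) w with hg
    have h1 : ⟪e (i + 1), w⟫_ℝ ^ 2 = 4 / ((i : ℝ) + 1) * m ^ 2 := by
      rw [inner_e_eq_mean (Nat.le_add_left 1 i), mul_pow, mul_pow, div_pow,
        Real.sq_sqrt (by positivity), ← pow_mul, mul_comm (i + 1), pow_mul]
      push_cast
      norm_num
      simp [hm]
    have h2 : g ^ 2 ≤ R ^ 2 * (1 / ((i : ℝ) + 1) ^ 2) := by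
      have := abs_mean_gap_le (Nat.le_add_left 1 i) w
      rw [← hg] at this
      rw [← sq_abs]
      calc |g| ^ 2 ≤ (R / ((i + 1 : ℕ) : ℝ)) ^ 2 := pow_le_pow_left₀ (abs_nonneg _) this 2
        _ = _ := by push_cast; rw [div_pow]; ring
    have h3 : D i ^ 2 ≤ V * |D i| := by
      rw [← sq_abs, sq]
      exact mul_le_mul_of_nonneg_right (hDi i) (abs_nonneg _)
    have h4 : m = g + D i := by simp only [D]; ring
    have h5 : m ^ 2 ≤ 2 * g ^ 2 + 2 * D i ^ 2 := by rw [h4]; nlinarith [sq_nonneg (g - D i)]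
    have h6 : 4 / ((i : ℝ) + 1) ≤ 4 := by
      rw [div_le_iff₀ (by positivity)]
      linarith
    rw [h1]
    calc _ ≤ 4 * m ^ 2 := mul_le_mul_of_nonneg_right h6 (sq_nonneg _)
      _ ≤ _ := by linarith
  refine (hasSum_sq_inner_e w).tsum_eq ▸ (hasSum_sq_inner_e w).summable.tsum_le_of_sum_range_le
    fun n => ?_
  calc _ ≤ ∑ i ∈ Finset.range n, (8 * R ^ 2 * (1 / ((i : ℝ) + 1) ^ 2) + 8 * (V * |D i|)) :=
        Finset.sum_le_sum fun i _ => hterm i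
    _ = 8 * R ^ 2 * (∑ i ∈ Finset.range n, 1 / ((i : ℝ) + 1) ^ 2)
        + 8 * (V * ∑ i ∈ Finset.range n, |D i|) := by
        rw [Finset.sum_add_distrib, Finset.mul_sum, Finset.mul_sum, Finset.mul_sum]
    _ ≤ _ := by
        have h1 := hs.sum_le_tsum (Finset.range n) fun i _ => by positivity
        have h2 := mul_le_mul_of_nonneg_left (hD n) hV
        have h3 := mul_le_mul_of_nonneg_left h1 (by positivity : (0 : ℝ) ≤ 8 * R ^ 2)
        nlinarith

/-- The total variation and `‖Λ w‖` together control the norm, although `Λ` is not bounded from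
below on `Htilde`. The gaps between the `I_j` are long, so the means of `w` over them are
square summable, and the total variation transfers this to the intervals `I_j`. -/
theorem exists_norm_le (h : Admissible M k c₀ b δ) (R : ℝ) {V : ℝ} (hV : 0 ≤ V) :
    ∃ K : ℝ, ∀ w : L2, ‖Λ M k c₀ b δ w‖ ≤ R → TV w ≤ ENNReal.ofReal V → ‖w‖ ≤ K := by
  refine ⟨Real.sqrt (8 * R ^ 2 * (∑' i : ℕ, 1 / ((i : ℝ) + 1) ^ 2) + 8 * V ^ 2) + R,
    fun w hw hTV => ?_⟩
  have h1 : ‖w - Htilde.starProjection w‖ ≤ R := (norm_sub_starProjection_le h w).trans hw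
  have h2 : ‖Htilde.starProjection w‖
      ≤ Real.sqrt (8 * R ^ 2 * (∑' i : ℕ, 1 / ((i : ℝ) + 1) ^ 2) + 8 * V ^ 2) := by
    refine Real.le_sqrt_of_sq_le ((norm_sq_starProjection_le hV hTV).trans ?_)
    have h3 : (0 : ℝ) ≤ ∑' i : ℕ, 1 / ((i : ℝ) + 1) ^ 2 := tsum_nonneg fun i => by positivity
    gcongr
  calc ‖w‖ = ‖Htilde.starProjection w + (w - Htilde.starProjection w)‖ := by
        rw [add_sub_cancel]
    _ ≤ _ := (norm_add_le _ _).trans (add_le_add h2 h1)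

/-! ### Existence and uniqueness of minimizers -/

/-- In a Hilbert space, a decreasing sequence of nonempty bounded closed convex sets has a common
point: the elements of least norm form a Cauchy sequence. -/
theorem exists_forall_mem_of_antitone {H : Type*} [NormedAddCommGroup H] [InnerProductSpace ℝ H]
    [CompleteSpace H] {S : ℕ → Set H} (hS : Antitone S) (hne : ∀ n, (S n).Nonempty)
    (hcl : ∀ n, IsClosed (S n)) (hconv : ∀ n, Convex ℝ (S n)) {K : ℝ}
    (hK : ∀ x ∈ S 0, ‖x‖ ≤ K) : ∃ x, ∀ n, x ∈ S n := by
  have hmin : ∀ n, ∃ v ∈ S n, ∀ w ∈ S n, ‖w - v‖ ^ 2 ≤ ‖w‖ ^ 2 - ‖v‖ ^ 2 := by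
    intro n
    obtain ⟨v, hv, hmin⟩ :=
      exists_norm_eq_iInf_of_complete_convex (hne n) (hcl n).isComplete (hconv n) 0
    refine ⟨v, hv, fun w hw => ?_⟩
    have h1 := (norm_eq_iInf_iff_real_inner_le_zero (hconv n) hv).1 hmin w hw
    rw [zero_sub, inner_neg_left, inner_sub_right, real_inner_self_eq_norm_sq] at h1
    rw [norm_sub_sq_real, real_inner_comm]
    linarith
  choose x hx hxmin using hmin
  have hle : ∀ {m n}, m ≤ n → ‖x n - x m‖ ^ 2 ≤ ‖x n‖ ^ 2 - ‖x m‖ ^ 2 := fun {m n} hmn =>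
    hxmin m _ (hS hmn (hx n))
  have hmono : Monotone fun n => ‖x n‖ ^ 2 := fun m n hmn => by
    have := hle hmn
    have := sq_nonneg ‖x n - x m‖
    simp only
    linarith
  have hbdd : BddAbove (Set.range fun n => ‖x n‖ ^ 2) := by
    refine ⟨K ^ 2, ?_⟩
    rintro _ ⟨n, rfl⟩
    exact pow_le_pow_left₀ (norm_nonneg _) (hK _ (hS n.zero_le (hx n))) 2
  have hcauchy : CauchySeq x := by
    have h1 := (tendsto_atTop_ciSup hmono hbdd).cauchySeq
    rw [Metric.cauchySeq_iff'] at h1 ⊢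
    intro ε hε
    obtain ⟨N, hN⟩ := h1 (ε ^ 2) (by positivity)
    refine ⟨N, fun n hn => ?_⟩
    have h2 := hN n hn
    rw [Real.dist_eq] at h2
    rw [dist_eq_norm]
    refine lt_of_pow_lt_pow_left₀ 2 hε.le ?_
    exact (hle hn).trans_lt ((le_abs_self _).trans_lt h2)
  obtain ⟨y, hy⟩ := cauchySeq_tendsto_of_complete hcauchy
  exact ⟨y, fun n => (hcl n).mem_of_tendsto hy
    ((eventually_ge_atTop n).mono fun m hm => hS hm (hx m))⟩

theorem functional_le_iff {L : L2 → L2} {f s u : L2} {lam c : ℝ} (hlam : 0 ≤ lam) (hc : 0 ≤ c) :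
    functional L f lam s u ≤ ENNReal.ofReal c ↔ ∀ (φ : ℝ → ℝ) (hφ : IsTest φ),
      lam * ‖f - L (s + u)‖ ^ 2 + ⟪hφ.memLp_deriv.toLp (deriv φ), u⟫_ℝ ≤ c := by
  constructor
  · intro h φ hφ
    rw [← ENNReal.ofReal_le_ofReal_iff hc]
    exact ENNReal.ofReal_add_le.trans ((add_le_add le_rfl (inner_toLp_deriv_le_TV hφ u)).trans h)
  · intro h
    have h0 : lam * ‖f - L (s + u)‖ ^ 2 ≤ c := by
      have := h _ IsTest.zero
      rwa [← integral_mul_eq_inner, deriv_const', integral_congr_ae (g := fun _ => (0 : ℝ))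
        (Eventually.of_forall fun x => by simp), integral_zero, add_zero] at this
    rw [functional, ← add_sub_cancel (lam * ‖f - L (s + u)‖ ^ 2) c,
      ENNReal.ofReal_add (by positivity) (sub_nonneg.2 h0)]
    refine add_le_add le_rfl (TV_le fun φ hφ => ENNReal.ofReal_le_ofReal ?_)
    linarith [h φ hφ]

theorem TV_zero : TV 0 = 0 := by
  refine le_antisymm (TV_le fun φ hφ => ?_) zero_le
  simp

theorem functional_zero_ne_top (L : L2 → L2) (f s : L2) (lam : ℝ) :
    functional L f lam s 0 ≠ ⊤ := by
  simp [functional, TV_zero]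

theorem isClosed_functional_le {L : L2 → L2} (hL : Continuous L) (f s : L2) {lam c : ℝ}
    (hlam : 0 ≤ lam) (hc : 0 ≤ c) :
    IsClosed {u | functional L f lam s u ≤ ENNReal.ofReal c} := by
  simp only [functional_le_iff hlam hc, Set.ofPred_forall]
  exact isClosed_iInter fun φ => isClosed_iInter fun hφ =>
    isClosed_le (by fun_prop) continuous_const

theorem norm_sq_convex (x y : L2) {p q : ℝ} (hp : 0 ≤ p) (hq : 0 ≤ q) (hpq : p + q = 1) :
    ‖p • x + q • y‖ ^ 2 ≤ p * ‖x‖ ^ 2 + q * ‖y‖ ^ 2 :=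
  ((convexOn_univ_norm (E := L2)).pow (fun _ _ => norm_nonneg _) 2).2 (Set.mem_univ x)
    (Set.mem_univ y) hp hq hpq

theorem convex_functional_le (L : L2 →L[ℝ] L2) (f s : L2) {lam c : ℝ}
    (hlam : 0 ≤ lam) (hc : 0 ≤ c) :
    Convex ℝ {u | functional L f lam s u ≤ ENNReal.ofReal c} := by
  intro u hu v hv p q hp hq hpq
  rw [Set.mem_ofPred_eq, functional_le_iff hlam hc] at hu hv ⊢
  intro φ hφ
  have h1 : f - L (s + (p • u + q • v)) = p • (f - L (s + u)) + q • (f - L (s + v)) := by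
    have hf : f = p • f + q • f := by rw [← add_smul, hpq, one_smul]
    have hs : L s = p • L s + q • L s := by rw [← add_smul, hpq, one_smul]
    simp only [map_add, map_smul]
    nth_rw 1 [hf, hs]
    module
  rw [h1, inner_add_right, real_inner_smul_right, real_inner_smul_right]
  have h2 := mul_le_mul_of_nonneg_left (norm_sq_convex (f - L (s + u)) (f - L (s + v)) hp hq hpq)
    hlam
  have h3 := mul_le_mul_of_nonneg_left (hu φ hφ) hp
  have h4 := mul_le_mul_of_nonneg_left (hv φ hφ) hq
  have h5 : p * c + q * c = c := by rw [← add_mul, hpq, one_mul]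
  nlinarith

theorem functional_congr {L L' : L2 → L2} (h : ∀ w, L w = L' w) (f s u : L2) (lam : ℝ) :
    functional L f lam s u = functional L' f lam s u := by
  rw [functional, functional, h]

theorem exists_isMinimizer (h : Admissible M k c₀ b δ) (f s : L2) {lam : ℝ} (hlam : 0 < lam) :
    ∃ u, IsMinimizer (Λ M k c₀ b δ) f lam s u := by
  set F := functional (Λ M k c₀ b δ) f lam s with hF
  have hFL : functional (ΛL M k c₀ b δ) f lam s = F :=
    funext fun u => functional_congr (ΛL_apply h) f s u lam
  obtain ⟨m, hm0, hm⟩ : ∃ m : ℝ, 0 ≤ m ∧ ⨅ u, F u = ENNReal.ofReal m := by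
    have hne : ⨅ u, F u ≠ ⊤ := ne_top_of_le_ne_top (functional_zero_ne_top _ f s lam) (iInf_le F 0)
    exact ⟨_, ENNReal.toReal_nonneg, (ENNReal.ofReal_toReal hne).symm⟩
  let c : ℕ → ℝ := fun n => m + 1 / ((n : ℝ) + 1)
  have hc : ∀ n, 0 ≤ c n := fun n => by positivity
  have hcm : ∀ n, m < c n := fun n => lt_add_of_pos_right _ (by positivity)
  obtain ⟨K, hK⟩ := exists_norm_le h (‖f - Λ M k c₀ b δ s‖ + Real.sqrt (c 0 / lam)) (hc 0)
  have hex : ∃ u, ∀ n, u ∈ {u | F u ≤ ENNReal.ofReal (c n)} := by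
    refine exists_forall_mem_of_antitone (K := K) ?_ ?_ ?_ ?_ ?_
    · intro i j hij u hu
      have hcij : c j ≤ c i := by
        simp only [c]
        gcongr
      exact le_trans hu (ENNReal.ofReal_le_ofReal hcij)
    · intro n
      have : ⨅ u, F u < ENNReal.ofReal (c n) := by
        rw [hm]
        exact (ENNReal.ofReal_lt_ofReal_iff (hm0.trans_lt (hcm n))).2 (hcm n)
      obtain ⟨u, hu⟩ := iInf_lt_iff.1 this
      exact ⟨u, hu.le⟩
    · intro n
      rw [← hFL]
      exact isClosed_functional_le (ΛL M k c₀ b δ).continuous f s hlam.le (hc n)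
    · intro n
      rw [← hFL]
      exact convex_functional_le (ΛL M k c₀ b δ) f s hlam.le (hc n)
    · intro u hu
      rw [Set.mem_ofPred_eq, hF, functional] at hu
      refine hK u ?_ (le_add_self.trans hu)
      have h1 : lam * ‖f - Λ M k c₀ b δ (s + u)‖ ^ 2 ≤ c 0 :=
        (ENNReal.ofReal_le_ofReal_iff (hc 0)).1 (le_self_add.trans hu)
      have h2 : ‖f - Λ M k c₀ b δ (s + u)‖ ≤ Real.sqrt (c 0 / lam) := by
        refine Real.le_sqrt_of_sq_le ?_
        rw [le_div_iff₀ hlam]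
        linarith
      have h3 : Λ M k c₀ b δ u = (f - Λ M k c₀ b δ s) - (f - Λ M k c₀ b δ (s + u)) := by
        rw [← ΛL_apply h, ← ΛL_apply h, ← ΛL_apply h, map_add]
        abel
      rw [h3]
      exact (norm_sub_le _ _).trans (add_le_add le_rfl h2)
  obtain ⟨u, hu⟩ := hex
  refine ⟨u, fun w => ?_⟩
  have hlim : Tendsto c atTop (𝓝 m) := by
    simpa [c] using tendsto_one_div_add_atTop_nhds_zero_nat.const_add m
  calc F u ≤ ENNReal.ofReal m :=
        ge_of_tendsto (ENNReal.tendsto_ofReal hlim) (Eventually.of_forall hu)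
    _ = ⨅ u, F u := hm.symm
    _ ≤ F w := iInf_le F w

theorem IsMinimizer.eq (h : Admissible M k c₀ b δ) {f s : L2} {lam : ℝ} (hlam : 0 < lam) {u v : L2}
    (hu : IsMinimizer (Λ M k c₀ b δ) f lam s u) (hv : IsMinimizer (Λ M k c₀ b δ) f lam s v) :
    u = v := by
  set F := functional (Λ M k c₀ b δ) f lam s with hF
  obtain ⟨m, hm0, hm⟩ : ∃ m : ℝ, 0 ≤ m ∧ F u = ENNReal.ofReal m :=
    ⟨_, ENNReal.toReal_nonneg, (ENNReal.ofReal_toReal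
      (ne_top_of_le_ne_top (functional_zero_ne_top _ f s lam) (hu 0))).symm⟩
  have h1 := (functional_le_iff hlam.le hm0).1 hm.le
  have h2 := (functional_le_iff hlam.le hm0).1 ((hv u).trans hm.le)
  set x := f - Λ M k c₀ b δ (s + u)
  set y := f - Λ M k c₀ b δ (s + v)
  set z := (1 / 2 : ℝ) • (u + v) with hz
  have hxy : x - y = Λ M k c₀ b δ (v - u) := by
    simp only [x, y, ← ΛL_apply h, map_add, map_sub]
    abel
  have hzz : f - Λ M k c₀ b δ (s + z) = (1 / 2 : ℝ) • (x + y) := by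
    simp only [x, y, hz, ← ΛL_apply h, map_add, map_smul]
    module
  have hpar := parallelogram_law_with_norm ℝ x y
  have hnorm : ‖f - Λ M k c₀ b δ (s + z)‖ ^ 2
      = (‖x‖ ^ 2 + ‖y‖ ^ 2) / 2 - ‖Λ M k c₀ b δ (v - u)‖ ^ 2 / 4 := by
    rw [hzz, norm_smul, mul_pow, ← hxy, Real.norm_of_nonneg (by norm_num)]
    nlinarith
  set q := lam * ‖Λ M k c₀ b δ (v - u)‖ ^ 2 / 4 with hq
  have h3 : ∀ (φ : ℝ → ℝ) (hφ : IsTest φ), lam * ‖f - Λ M k c₀ b δ (s + z)‖ ^ 2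
      + ⟪hφ.memLp_deriv.toLp (deriv φ), z⟫_ℝ ≤ m - q := by
    intro φ hφ
    have h4 := h1 φ hφ
    have h5 := h2 φ hφ
    rw [hnorm, hz, real_inner_smul_right, inner_add_right, hq]
    linarith
  have hmq : 0 ≤ m - q := by
    have h4 := h3 _ IsTest.zero
    rw [← integral_mul_eq_inner, deriv_const', integral_congr_ae (g := fun _ => (0 : ℝ))
      (Eventually.of_forall fun x => by simp), integral_zero, add_zero] at h4
    exact le_trans (by positivity) h4
  have h4 : ENNReal.ofReal m ≤ ENNReal.ofReal (m - q) :=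
    hm ▸ (hu z).trans ((functional_le_iff hlam.le hmq).2 h3)
  rw [ENNReal.ofReal_le_ofReal_iff hmq] at h4
  have h5 : ‖Λ M k c₀ b δ (v - u)‖ ^ 2 = 0 := by
    refine le_antisymm ?_ (sq_nonneg _)
    by_contra h6
    have : 0 < q := by
      rw [hq]
      have := not_le.1 h6
      positivity
    linarith
  have h6 := eq_zero_of_Λ_eq_zero h (norm_eq_zero.1 (pow_eq_zero_iff two_ne_zero |>.1 h5))
  exact (sub_eq_zero.1 h6).symm

theorem existsUnique_isMinimizer (h : Admissible M k c₀ b δ) (f s : L2) {lam : ℝ} (hlam : 0 < lam) :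
    ∃! u, IsMinimizer (Λ M k c₀ b δ) f lam s u := by
  obtain ⟨u, hu⟩ := exists_isMinimizer h f s hlam
  exact ⟨u, hu, fun v hv => hv.eq h hlam hu⟩

/-! ### The optimality condition -/

/-- If `p = 2 lam Λ* (f - Λ (s + u))` satisfies `⟪p, w⟫ ≤ |Dw|(ℝ)` for all `w`, with equality at
`u`, then `p` is a subgradient of the total variation at `u`, and so `u` is a minimizer. -/
theorem isMinimizer_of_inner_le_TV (h : Admissible M k c₀ b δ) {f s u : L2} {lam : ℝ}
    (hlam : 0 ≤ lam)
    (hle : ∀ w, ENNReal.ofReal (2 * lam * ⟪f - Λ M k c₀ b δ (s + u), Λ M k c₀ b δ w⟫_ℝ) ≤ TV w)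
    (h0 : 0 ≤ 2 * lam * ⟪f - Λ M k c₀ b δ (s + u), Λ M k c₀ b δ u⟫_ℝ)
    (hge : TV u ≤ ENNReal.ofReal (2 * lam * ⟪f - Λ M k c₀ b δ (s + u), Λ M k c₀ b δ u⟫_ℝ)) :
    IsMinimizer (Λ M k c₀ b δ) f lam s u := by
  intro w
  have hw := hle w
  rcases eq_or_ne (TV w) ⊤ with htop | htop
  · simp [functional, htop]
  · set r := f - Λ M k c₀ b δ (s + u) with hr
    have hrw : f - Λ M k c₀ b δ (s + w) = r - Λ M k c₀ b δ (w - u) := by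
      simp only [hr, ← ΛL_apply h, map_add, map_sub]
      abel
    rw [← ENNReal.ofReal_toReal htop, ENNReal.ofReal_le_ofReal_iff ENNReal.toReal_nonneg] at hw
    refine (add_le_add le_rfl hge).trans ?_
    rw [functional, ← ENNReal.ofReal_toReal htop, ← ENNReal.ofReal_add (by positivity) h0,
      ← ENNReal.ofReal_add (by positivity) ENNReal.toReal_nonneg]
    refine ENNReal.ofReal_le_ofReal ?_
    rw [hrw, Λ_sub h, norm_sub_sq_real r, inner_sub_right, ← hr]
    have := mul_nonneg hlam (sq_nonneg ‖Λ M k c₀ b δ w - Λ M k c₀ b δ u‖)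
    nlinarith

/-! ### Alternating sums -/

theorem alternating_sum_mem {E : ℕ → ℝ} (hE : Antitone E) (h0 : ∀ i, 0 ≤ E i) (r : ℕ) :
    0 ≤ ∑ i ∈ Finset.range r, (-1) ^ i * E i ∧ ∑ i ∈ Finset.range r, (-1) ^ i * E i ≤ E 0 := by
  induction r generalizing E with
  | zero => simpa using h0 0
  | succ r ih =>
    obtain ⟨h1, h2⟩ := ih (E := fun i => E (i + 1)) (fun i j hij => hE (by omega))
      (fun i => h0 _)
    have h3 : ∑ i ∈ Finset.range (r + 1), (-1) ^ i * E i
        = E 0 - ∑ i ∈ Finset.range r, (-1) ^ i * E (i + 1) := by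
      rw [Finset.sum_range_succ', sub_eq_add_neg, ← Finset.sum_neg_distrib, add_comm]
      congr 1
      · simp
      · exact Finset.sum_congr rfl fun i _ => by ring
    rw [h3]
    simp only [zero_add] at h2
    have := hE zero_le_one
    constructor <;> linarith

theorem abs_neg_one_pow_mul_le {A : ℝ} (n : ℕ) (h0 : 0 ≤ A) (h1 : A ≤ 1) :
    |(-1) ^ n * (1 - 2 * A)| ≤ 1 := by
  rw [abs_mul, abs_pow, abs_neg, abs_one, one_pow, one_mul, abs_le]
  constructor <;> linarith

/-- Let `D_2, D_3, …` increase up to `D_{n + 2} = 1` and decrease from there on, and let `D_1` be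
small. Then the partial sums of `∑ 2 (-1)^j D_j` stay in `[-1, 1]` after adding a constant, which
is chosen so that the jump of index `n + 2` leads from one end point of `[-1, 1]` to the other.
The sequences `E` and `F` are `D` read to the left and to the right from `n + 2`. -/
theorem exists_const_abs_add_sum_le {D E F : ℕ → ℝ} {n : ℕ} (hE : Antitone E) (hF : Antitone F)
    (hE0 : ∀ i, 0 ≤ E i) (hF0 : ∀ i, 0 ≤ F i) (hE1 : E 0 = 1) (hF1 : F 0 = 1)
    (hDE : ∀ s ≤ n, D (n + 2 - s) = E s) (hDF : ∀ l, D (n + 2 + l) = F l)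
    (h0 : 0 ≤ D 1) (h1 : D 1 ≤ 1) (h2 : D 1 ≤ 1 - E 1) (h3 : D 1 ≤ E 1 - E 2) :
    ∃ c : ℝ, ∀ m, |c + ∑ i ∈ Finset.range m, 2 * (-1) ^ (i + 1) * D (i + 1)| ≤ 1 := by
  let P : ℕ → ℝ := fun m => ∑ i ∈ Finset.range m, 2 * (-1) ^ (i + 1) * D (i + 1)
  have hP : ∀ m, P (m + 1) = P m + 2 * (-1) ^ (m + 1) * D (m + 1) := fun m =>
    Finset.sum_range_succ _ _
  have hright : ∀ l, P (n + 2 + l) - P (n + 2)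
      = (-1) ^ n * (-2 * ∑ i ∈ Finset.range l, (-1) ^ i * F (i + 1)) := by
    intro l
    induction l with
    | zero => simp
    | succ l ih =>
      rw [← add_assoc, hP, Finset.sum_range_succ, add_assoc (n + 2) l 1, hDF]
      have : P (n + 2 + l) = P (n + 2)
          + (-1) ^ n * (-2 * ∑ i ∈ Finset.range l, (-1) ^ i * F (i + 1)) := by linarith
      rw [this]
      ring
  have hleft : ∀ s ≤ n + 1, P (n + 2) - P (n + 2 - s)
      = (-1) ^ n * (2 * ∑ i ∈ Finset.range s, (-1) ^ i * E i) := by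
    intro s hs
    induction s with
    | zero => simp
    | succ s ih =>
      have ih := ih (by omega)
      have hDs := hDE s (by omega)
      obtain ⟨t, rfl⟩ := Nat.exists_eq_add_of_le (by omega : s ≤ n)
      rw [show s + t + 2 - s = t + 1 + 1 by omega] at ih hDs
      rw [show s + t + 2 - (s + 1) = t + 1 by omega, Finset.sum_range_succ, ← hDs]
      have h4 := hP (t + 1)
      have h5 : (-1 : ℝ) ^ (s + t) * (-1) ^ s = (-1) ^ t := by
        rw [pow_add, mul_right_comm, ← mul_pow]
        simp
      have h6 : (-1 : ℝ) ^ (t + 1 + 1) = (-1) ^ t := by ring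
      rw [h6] at h4
      linear_combination ih + h4 - 2 * D (t + 1 + 1) * h5
  refine ⟨(-1) ^ n - P (n + 2), fun m => ?_⟩
  change |(-1) ^ n - P (n + 2) + P m| ≤ 1
  rcases le_total (n + 2) m with hm | hm
  · obtain ⟨l, rfl⟩ := Nat.exists_eq_add_of_le hm
    obtain ⟨h4, h5⟩ := alternating_sum_mem (E := fun i => F (i + 1))
      (fun i j hij => hF (by omega)) (fun i => hF0 _) l
    have h6 : (-1) ^ n - P (n + 2) + P (n + 2 + l)
        = (-1) ^ n * (1 - 2 * ∑ i ∈ Finset.range l, (-1) ^ i * F (i + 1)) := by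
      linear_combination hright l
    rw [h6]
    refine abs_neg_one_pow_mul_le n h4 (h5.trans ?_)
    rw [← hF1]
    exact hF (by omega)
  · rcases Nat.eq_zero_or_pos m with rfl | hm0
    · have h4 := hleft (n + 1) le_rfl
      rw [show n + 2 - (n + 1) = 0 + 1 by omega, hP 0] at h4
      have hP0 : P 0 = 0 := by simp [P]
      have h5 : (-1 : ℝ) ^ n * (-1) ^ n = 1 := by rw [← mul_pow]; simp
      have h6 : (-1) ^ n - P (n + 2) + P 0 = (-1) ^ n
          * (1 - 2 * (∑ i ∈ Finset.range (n + 1), (-1) ^ i * E i - (-1) ^ n * D 1)) := by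
        rw [hP0] at h4 ⊢
        simp only [zero_add, pow_one] at h4
        linear_combination -h4 - 2 * D 1 * h5
      rw [h6]
      have h7 : |(-1) ^ n * D 1| ≤ D 1 := by
        rw [abs_mul, abs_pow, abs_neg, abs_one, one_pow, one_mul, abs_of_nonneg h0]
      have h8 := abs_le.1 h7
      rcases n with _ | n
      · simp only [zero_add, Finset.sum_range_one, pow_zero, one_mul, hE1]
        have := abs_neg_one_pow_mul_le 0 (sub_nonneg.2 h1) (by linarith)
        simpa using this
      · obtain ⟨h9, h10⟩ := alternating_sum_mem (E := fun i => E (i + 2))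
          (fun i j hij => hE (by omega)) (fun i => hE0 _) n
        have h11 : ∑ i ∈ Finset.range (n + 1 + 1), (-1) ^ i * E i
            = 1 - E 1 + ∑ i ∈ Finset.range n, (-1) ^ i * E (i + 2) := by
          rw [Finset.sum_range_succ', Finset.sum_range_succ']
          simp only [pow_succ, hE1]
          ring_nf
        rw [h11]
        simp only [zero_add] at h10
        exact abs_neg_one_pow_mul_le _ (by linarith) (by linarith)
    · have h4 := hleft (n + 2 - m) (by omega)
      rw [show n + 2 - (n + 2 - m) = m by omega] at h4
      obtain ⟨h5, h6⟩ := alternating_sum_mem hE hE0 (n + 2 - m)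
      have h7 : (-1) ^ n - P (n + 2) + P m
          = (-1) ^ n * (1 - 2 * ∑ i ∈ Finset.range (n + 2 - m), (-1) ^ i * E i) := by
        linear_combination -h4
      rw [h7]
      exact abs_neg_one_pow_mul_le n h5 (hE1 ▸ h6)

/-! ### The residuals -/

theorem Λ_smul (h : Admissible M k c₀ b δ) (c : ℝ) (w : L2) :
    Λ M k c₀ b δ (c • w) = c • Λ M k c₀ b δ w := by
  simp only [← ΛL_apply h, map_smul]

theorem Λ_σ (h : Admissible M k c₀ b δ) (n : ℕ) :
    Λ M k c₀ b δ (σ b n) = ∑ j ∈ Finset.range (n + 1),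
      (b / Real.sqrt ((j : ℝ) + 2)) • image₂ M k c₀ b δ (j + 2) := by
  rw [← ΛL_apply h, σ, map_sum]
  refine Finset.sum_congr rfl fun j _ => ?_
  rw [map_smul, ΛL_apply h, Λ_e h (j + 1), image_of_two_le (by omega)]

theorem ρ_sub_sum_B (m n : ℕ) :
    ρ k δ m - ∑ j ∈ Finset.range n, B k δ (m - j) = ρ k δ (m - n) := by
  induction n with
  | zero => simp
  | succ n ih =>
    rw [Finset.sum_range_succ, ← sub_sub, ih]
    rcases Nat.eq_zero_or_pos (m - n) with h | h
    · rw [h, show m - (n + 1) = 0 by omega, B_zero, sub_zero]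
    · rw [show m - n = m - (n + 1) + 1 by omega, ρ_succ, add_sub_cancel_right]

/-- The residual of the datum `Λ e_1` after `n + 1` steps. -/
noncomputable def residual (M : ℝ) (k : ℕ) (c₀ b δ : ℝ) (n : ℕ) : L2 :=
  Λ M k c₀ b δ (e 1) - Λ M k c₀ b δ (σ b n)

theorem residual_mem_Htilde (h : Admissible M k c₀ b δ) (n : ℕ) :
    residual M k c₀ b δ n ∈ Htilde := by
  refine Htilde.sub_mem ?_ ?_
  · rw [Λ_e h 0]
    exact image_mem_Htilde h le_rfl
  · rw [Λ_σ h]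
    refine Htilde.sum_mem fun j _ => Htilde.smul_mem _ ?_
    rw [← image_of_two_le (by omega)]
    exact image_mem_Htilde h (by omega)

/-- Up to the factors `η_m`, the residual is the datum shifted by `n + 1` indices. -/
theorem inner_e_residual (h : Admissible M k c₀ b δ) {m : ℕ} (hm : 1 ≤ m) (n : ℕ) :
    ⟪e m, residual M k c₀ b δ n⟫_ℝ = ρ k δ (m - (n + 1)) * η M c₀ m := by
  have hb := h.b_pos
  rw [residual, inner_sub_right, Λ_e h 0, image_one, inner_e_image₁ h hm, Λ_σ h, inner_sum,
    ← ρ_sub_sum_B, sub_mul, Finset.sum_mul]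
  congr 1
  refine Finset.sum_congr rfl fun j _ => ?_
  have h2 : 0 < Real.sqrt ((j : ℝ) + 2) := Real.sqrt_pos.2 (by positivity)
  rw [real_inner_smul_right, inner_e_image₂ h hm (by omega), show m + 2 - (j + 2) = m - j by omega]
  push_cast
  field_simp

theorem inner_residual_image₂ (h : Admissible M k c₀ b δ) {j : ℕ} (hj : 2 ≤ j) (n : ℕ) :
    ⟪residual M k c₀ b δ n, image₂ M k c₀ b δ j⟫_ℝ = Real.sqrt j / b * (c₀ *
      ∑ i ∈ Finset.range (k + 1),
        B k δ (i + 1) * M⁻¹ ^ (j + i - 1) * ρ k δ (j + i - 1 - (n + 1))) := by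
  rw [image₂_eq h, real_inner_smul_right, inner_sum, Finset.range_eq_Ico]
  congr 1
  have hIcc : Finset.Icc 1 (k + 1) = Finset.Ico (0 + 1) (k + 1 + 1) := rfl
  rw [hIcc, ← Finset.sum_Ico_add' _ 0 (k + 1) 1, Finset.mul_sum]
  refine Finset.sum_congr rfl fun i _ => ?_
  rw [real_inner_smul_right, real_inner_comm, inner_e_residual h (by omega),
    show j + (i + 1) - 2 = j + i - 1 by omega]
  linear_combination B k δ (i + 1) * ρ k δ (j + i - 1 - (n + 1)) * η_sq h (j + i - 1)

theorem inner_residual_image₁ (h : Admissible M k c₀ b δ) (n : ℕ) :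
    0 ≤ ⟪residual M k c₀ b δ n, image₁ M k c₀ δ⟫_ℝ ∧
      M ^ n * ⟪residual M k c₀ b δ n, image₁ M k c₀ δ⟫_ℝ ≤ c₀ / 2 := by
  have hsum := (hasSum_image₁ h).mapL (innerSL ℝ (residual M k c₀ b δ n))
  have hterm : ∀ m, innerSL ℝ (residual M k c₀ b δ n)
      ((ρ k δ (m + 1) * η M c₀ (m + 1)) • e (m + 1))
      = ρ k δ (m + 1) * ρ k δ (m - n) * (c₀ * M⁻¹ ^ (m + 1)) := fun m => by
    rw [innerSL_apply_apply, real_inner_smul_right, real_inner_comm,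
      inner_e_residual h (by omega), show m + 1 - (n + 1) = m - n by omega]
    linear_combination ρ k δ (m + 1) * ρ k δ (m - n) * η_sq h (m + 1)
  simp only [hterm, innerSL_apply_apply] at hsum
  have hM := h.M_pos
  have hc := h.c₀_pos
  have hx : M⁻¹ ≤ 1 / 2 := by
    rw [one_div]
    exact inv_anti₀ two_pos h.two_le_M
  have hx0 : 0 < M⁻¹ := inv_pos.2 hM
  refine ⟨hsum.nonneg fun m => mul_nonneg (mul_nonneg (ρ_nonneg h _) (ρ_nonneg h _))
    (by positivity), ?_⟩
  have htail := (hasSum_nat_add_iff' (n + 1)).2 hsum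
  rw [Finset.sum_eq_zero fun m hm => by
    rw [show m - n = 0 by have := Finset.mem_range.1 hm; omega, ρ_zero]; ring, sub_zero] at htail
  have hgeo := (hasSum_geometric_of_lt_one hx0.le (by linarith)).mul_left (c₀ * M⁻¹ ^ (n + 2))
  have hle := hasSum_le (fun m => by
    have h1 := mul_le_one₀ (ρ_le_one h (m + (n + 1) + 1)) (ρ_nonneg h (m + (n + 1) - n))
      (ρ_le_one h _)
    calc _ ≤ 1 * (c₀ * M⁻¹ ^ (m + (n + 1) + 1)) :=
          mul_le_mul_of_nonneg_right h1 (by positivity)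
      _ = c₀ * M⁻¹ ^ (n + 2) * M⁻¹ ^ m := by ring) htail hgeo
  have h1 : M ^ n * M⁻¹ ^ n = 1 := by rw [← mul_pow, mul_inv_cancel₀ hM.ne', one_pow]
  calc _ ≤ M ^ n * (c₀ * M⁻¹ ^ (n + 2) * (1 - M⁻¹)⁻¹) :=
        mul_le_mul_of_nonneg_left hle (by positivity)
    _ = c₀ * (M⁻¹ ^ 2 / (1 - M⁻¹)) := by
        rw [pow_add]
        linear_combination c₀ * M⁻¹ ^ 2 * (1 - M⁻¹)⁻¹ * h1
    _ ≤ c₀ * (1 / 2) := by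
        refine mul_le_mul_of_nonneg_left ?_ hc.le
        rw [div_le_iff₀ (by linarith)]
        nlinarith
    _ = c₀ / 2 := by ring

/-! ### The choice of the parameters -/

/-- The values `D_{n + 2 - s}` for `k = 5` and `δ = 11 / 60` before normalization, as a function
of `t = 5 - s`. -/
noncomputable def leftProfile (M : ℝ) (t : ℕ) : ℝ :=
  11 / 60 * ∑ m ∈ Finset.range t, ρ 5 (11 / 60) (m + 1) * M⁻¹ ^ (m + 2)

/-- The values `D_{n + 2 + l}` for `k = 5` and `δ = 11 / 60` before normalization. -/
noncomputable def rightProfile (M : ℝ) (l : ℕ) : ℝ :=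
  ∑ i ∈ Finset.range 6, B 5 (11 / 60) (i + 1) * M⁻¹ ^ (l + i + 1) * ρ 5 (11 / 60) (l + i)

theorem ρ_five_succ {m : ℕ} (hm : m ≤ 5) : ρ 5 (11 / 60) (m + 1) = 1 / 12 + m * (11 / 60) := by
  rw [ρ_succ_of_le hm]
  norm_num

theorem B_five_one : B 5 (11 / 60) 1 = 1 / 12 := by
  rw [B_one]
  norm_num

theorem B_five {i : ℕ} (h1 : 2 ≤ i) (h2 : i ≤ 6) : B 5 (11 / 60) i = 11 / 60 := B_of_le h1 h2

theorem rightProfile_eq (M : ℝ) (l : ℕ) :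
    rightProfile M l = M⁻¹ ^ (l + 1) * (1 / 12 * ρ 5 (11 / 60) l + 11 / 60 *
      (M⁻¹ * ρ 5 (11 / 60) (l + 1) + M⁻¹ ^ 2 * ρ 5 (11 / 60) (l + 2)
        + M⁻¹ ^ 3 * ρ 5 (11 / 60) (l + 3) + M⁻¹ ^ 4 * ρ 5 (11 / 60) (l + 4)
        + M⁻¹ ^ 5 * ρ 5 (11 / 60) (l + 5))) := by
  simp only [rightProfile, Finset.sum_range_succ, Finset.sum_range_zero, zero_add, add_zero,
    B_five_one]
  rw [B_five (by norm_num) (by norm_num), B_five (by norm_num) (by norm_num),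
    B_five (by norm_num) (by norm_num), B_five (by norm_num) (by norm_num),
    B_five (by norm_num) (by norm_num)]
  ring

theorem rightProfile_zero (M : ℝ) : rightProfile M 0 = leftProfile M 5 := by
  rw [rightProfile_eq, leftProfile]
  simp only [Finset.sum_range_succ, Finset.sum_range_zero, zero_add, ρ_zero]
  ring

theorem sum_eq_leftProfile (M : ℝ) (s : ℕ) :
    ∑ i ∈ Finset.range 6, B 5 (11 / 60) (i + 1) * (M⁻¹ ^ (i - s + 1) * ρ 5 (11 / 60) (i - s))
      = leftProfile M (5 - s) := by
  rcases le_or_gt s 4 with hs | hs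
  · simp only [leftProfile, Finset.sum_range_succ, Finset.sum_range_zero, zero_add]
    rw [B_five (i := 1 + 1) (by norm_num) (by norm_num),
      B_five (i := 2 + 1) (by norm_num) (by norm_num),
      B_five (i := 3 + 1) (by norm_num) (by norm_num),
      B_five (i := 4 + 1) (by norm_num) (by norm_num),
      B_five (i := 5 + 1) (by norm_num) (by norm_num)]
    interval_cases s <;>
      simp only [Finset.sum_range_succ, Finset.sum_range_zero, ρ_zero, Nat.reduceSub,
        Nat.reduceAdd] <;> ring
  · rw [show 5 - s = 0 by omega, leftProfile, Finset.sum_range_zero, mul_zero]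
    refine Finset.sum_eq_zero fun i hi => ?_
    rw [show i - s = 0 by have := Finset.mem_range.1 hi; omega, ρ_zero]
    ring

variable {α₀ : ℝ}

theorem inv_le_half (hM : 2 ≤ M) : M⁻¹ ≤ 1 / 2 := by
  rw [one_div]
  exact inv_anti₀ two_pos hM

theorem admissible_five (hM : 2 ≤ M) (hc : 0 < c₀) (hb : 0 < b) :
    Admissible M 5 c₀ b (11 / 60) where
  two_le_M := hM
  three_le_k := by norm_num
  c₀_pos := hc
  b_pos := hb
  δ_pos := by norm_num
  δ_lt := by norm_num

theorem ρ_five_nonneg (m : ℕ) : 0 ≤ ρ 5 (11 / 60) m :=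
  ρ_nonneg (admissible_five (M := 2) (c₀ := 1) (b := 1) le_rfl one_pos one_pos) m

theorem ρ_five_mono : Monotone (ρ 5 (11 / 60)) :=
  ρ_mono (admissible_five (M := 2) (c₀ := 1) (b := 1) le_rfl one_pos one_pos)

theorem rightProfile_nonneg (hM : 2 ≤ M) (l : ℕ) : 0 ≤ rightProfile M l := by
  have hx : 0 < M⁻¹ := inv_pos.2 (by linarith)
  have := ρ_five_nonneg
  rw [rightProfile_eq]
  have h1 := this l
  have h2 := this (l + 1)
  have h3 := this (l + 2)
  have h4 := this (l + 3)
  have h5 := this (l + 4)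
  have h6 := this (l + 5)
  positivity

/-- The choice `k = 5` enters here: the negative term of the difference of two consecutive values
has the factor `M⁻¹ ^ k`, and `M⁻¹ ^ 5 ≤ 1 / 32` is small enough for `δ = 11 / 60`. -/
theorem rightProfile_antitone (hM : 2 ≤ M) : Antitone (rightProfile M) := by
  refine antitone_nat_of_succ_le fun l => ?_
  have hx : 0 < M⁻¹ := inv_pos.2 (by linarith)
  have hx5 : M⁻¹ ^ 5 ≤ 1 / 32 := by
    calc M⁻¹ ^ 5 ≤ (1 / 2) ^ 5 := pow_le_pow_left₀ hx.le (inv_le_half hM) 5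
      _ = 1 / 32 := by norm_num
  have h1 : 1 / 12 ≤ ρ 5 (11 / 60) (l + 1) := by
    have := ρ_five_mono (show 0 + 1 ≤ l + 1 by omega)
    rw [ρ_five_succ (by norm_num)] at this
    simpa using this
  have h2 : ρ 5 (11 / 60) (l + 1 + 5) = 1 := ρ_of_ge (by omega)
  have h3 : rightProfile M l - rightProfile M (l + 1) = M⁻¹ ^ (l + 1) *
      (1 / 12 * ρ 5 (11 / 60) l + M⁻¹ * (1 / 10 * ρ 5 (11 / 60) (l + 1) - 11 / 60 * M⁻¹ ^ 5)) := by
    rw [rightProfile_eq, rightProfile_eq, h2]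
    ring_nf
  have h4 := ρ_five_nonneg l
  have h5 : 0 ≤ 1 / 10 * ρ 5 (11 / 60) (l + 1) - 11 / 60 * M⁻¹ ^ 5 := by linarith
  have h6 : 0 ≤ rightProfile M l - rightProfile M (l + 1) := by
    rw [h3]
    positivity
  linarith

theorem leftProfile_mono (hM : 2 ≤ M) : Monotone (leftProfile M) := by
  refine monotone_nat_of_le_succ fun t => ?_
  have hx : 0 < M⁻¹ := inv_pos.2 (by linarith)
  have := ρ_five_nonneg (t + 1)
  rw [leftProfile, leftProfile, Finset.sum_range_succ, mul_add]
  exact le_add_of_nonneg_right (by positivity)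

theorem leftProfile_nonneg (hM : 2 ≤ M) (t : ℕ) : 0 ≤ leftProfile M t := by
  simpa [leftProfile] using leftProfile_mono hM t.zero_le

theorem leftProfile_succ_sub (M : ℝ) {t : ℕ} (ht : t ≤ 5) :
    leftProfile M (t + 1) - leftProfile M t
      = 11 / 60 * ((1 / 12 + t * (11 / 60)) * M⁻¹ ^ (t + 2)) := by
  rw [leftProfile, leftProfile, Finset.sum_range_succ, ρ_five_succ ht]
  ring

theorem leftProfile_five_pos (hM : 2 ≤ M) : 0 < leftProfile M 5 := by
  have hx : 0 < M⁻¹ := inv_pos.2 (by linarith)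
  have h1 := leftProfile_succ_sub M (show 4 ≤ 5 by norm_num)
  have h2 := leftProfile_nonneg hM 4
  have h3 : (0 : ℝ) < 11 / 60 * ((1 / 12 + (4 : ℕ) * (11 / 60)) * M⁻¹ ^ (4 + 2)) := by positivity
  linarith

theorem leftProfile_five_le_one (hM : 2 ≤ M) : leftProfile M 5 ≤ 1 := by
  have hx : 0 < M⁻¹ := inv_pos.2 (by linarith)
  have h1 : ∑ m ∈ Finset.range 5, ρ 5 (11 / 60) (m + 1) * M⁻¹ ^ (m + 2)
      ≤ ∑ m ∈ Finset.range 5, (1 : ℝ) := by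
    refine Finset.sum_le_sum fun m _ => mul_le_one₀ ?_ (by positivity) ?_
    · exact ρ_le_one (admissible_five (M := 2) (c₀ := 1) (b := 1) le_rfl one_pos one_pos) _
    · exact pow_le_one₀ hx.le (by linarith [inv_le_half hM])
  rw [leftProfile]
  norm_num at h1 ⊢
  linarith

/-- The constant `c₀` for `k = 5` and `δ = 11 / 60`. The factor `38 / 60` is `ρ_4`. The power of
`M⁻¹` makes the jump over `I_1` small compared to the gaps in the sequence of the other jumps. -/
noncomputable def c₀Five (M α₀ : ℝ) : ℝ := 11 / 60 * (38 / 60) * M⁻¹ ^ 6 / α₀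

/-- The constant `b` for `k = 5` and `δ = 11 / 60`: the normalization that makes the jump over
`I_{n + 2}` at the `n`-th step equal to `2` in absolute value. -/
noncomputable def bFive (M α₀ : ℝ) : ℝ := 2 * α₀ * c₀Five M α₀ * leftProfile M 5

theorem c₀Five_pos (hM : 2 ≤ M) (hα : 0 < α₀) : 0 < c₀Five M α₀ := by
  have hx : 0 < M⁻¹ := inv_pos.2 (by linarith)
  unfold c₀Five
  positivity

theorem bFive_pos (hM : 2 ≤ M) (hα : 0 < α₀) : 0 < bFive M α₀ :=
  mul_pos (mul_pos (mul_pos two_pos hα) (c₀Five_pos hM hα)) (leftProfile_five_pos hM)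

theorem admissible_c₀Five (hM : 2 ≤ M) (hα : 0 < α₀) :
    Admissible M 5 (c₀Five M α₀) (bFive M α₀) (11 / 60) :=
  admissible_five hM (c₀Five_pos hM hα) (bFive_pos hM hα)

/-- The coefficients of the subgradient `2 lam_n Λ* r_n` in the orthonormal system, where `r_n` is
the residual after the step `n`. -/
noncomputable def subgradientCoeff (M α₀ : ℝ) (n j : ℕ) : ℝ :=
  2 * (α₀ * M ^ n) * ⟪residual M 5 (c₀Five M α₀) (bFive M α₀) (11 / 60) n,
    image M 5 (c₀Five M α₀) (bFive M α₀) (11 / 60) j⟫_ℝ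

theorem subgradientCoeff_of_two_le (hM : 2 ≤ M) (hα : 0 < α₀) (n : ℕ) {j : ℕ} (hj : 2 ≤ j) :
    subgradientCoeff M α₀ n j / Real.sqrt j = (M ^ n * ∑ i ∈ Finset.range 6,
      B 5 (11 / 60) (i + 1) * M⁻¹ ^ (j + i - 1) * ρ 5 (11 / 60) (j + i - 1 - (n + 1)))
        / leftProfile M 5 := by
  have hc := c₀Five_pos hM hα
  have hK := leftProfile_five_pos hM
  have hj0 : 0 < Real.sqrt j := Real.sqrt_pos.2 (by exact_mod_cast (by omega : 0 < j))
  rw [subgradientCoeff, image_of_two_le hj, inner_residual_image₂ (admissible_c₀Five hM hα) hj]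
  generalize ∑ i ∈ Finset.range (5 + 1), B 5 (11 / 60) (i + 1) * M⁻¹ ^ (j + i - 1)
    * ρ 5 (11 / 60) (j + i - 1 - (n + 1)) = S
  rw [bFive]
  field_simp

theorem subgradientCoeff_right (hM : 2 ≤ M) (hα : 0 < α₀) (n l : ℕ) :
    subgradientCoeff M α₀ n (n + 2 + l) / Real.sqrt ((n + 2 + l : ℕ) : ℝ)
      = rightProfile M l / leftProfile M 5 := by
  have h1 : M ^ n * M⁻¹ ^ n = 1 := by
    rw [← mul_pow, mul_inv_cancel₀ (by linarith), one_pow]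
  rw [subgradientCoeff_of_two_le hM hα n (by omega), rightProfile, Finset.mul_sum]
  congr 1
  refine Finset.sum_congr rfl fun i _ => ?_
  rw [show n + 2 + l + i - 1 = n + (l + i + 1) by omega,
    show n + (l + i + 1) - (n + 1) = l + i by omega, pow_add]
  linear_combination B 5 (11 / 60) (i + 1) * M⁻¹ ^ (l + i + 1) * ρ 5 (11 / 60) (l + i) * h1

theorem subgradientCoeff_left (hM : 2 ≤ M) (hα : 0 < α₀) {n s : ℕ} (hs : s ≤ n) :
    subgradientCoeff M α₀ n (n + 2 - s) / Real.sqrt ((n + 2 - s : ℕ) : ℝ)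
      = leftProfile M (5 - s) / leftProfile M 5 := by
  have h1 : M ^ n * M⁻¹ ^ n = 1 := by
    rw [← mul_pow, mul_inv_cancel₀ (by linarith), one_pow]
  rw [subgradientCoeff_of_two_le hM hα n (by omega), ← sum_eq_leftProfile, Finset.mul_sum]
  congr 1
  refine Finset.sum_congr rfl fun i _ => ?_
  rw [show n + 2 - s + i - 1 - (n + 1) = i - s by omega]
  rcases le_or_gt i s with his | his
  · rw [show i - s = 0 by omega, ρ_zero]
    ring
  · rw [show n + 2 - s + i - 1 = n + (i - s + 1) by omega, pow_add]
    linear_combination B 5 (11 / 60) (i + 1) * M⁻¹ ^ (i - s + 1) * ρ 5 (11 / 60) (i - s) * h1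

theorem subgradientCoeff_one (hM : 2 ≤ M) (hα : 0 < α₀) (n : ℕ) :
    0 ≤ subgradientCoeff M α₀ n 1 ∧
      subgradientCoeff M α₀ n 1 ≤ 11 / 60 * (38 / 60) * M⁻¹ ^ 6 := by
  have hM0 : 0 < M := by linarith
  obtain ⟨h1, h2⟩ := inner_residual_image₁ (admissible_c₀Five hM hα) n
  rw [subgradientCoeff, image_one]
  refine ⟨by positivity, ?_⟩
  calc _ = 2 * α₀ * (M ^ n * ⟪residual M 5 (c₀Five M α₀) (bFive M α₀) (11 / 60) n,
        image₁ M 5 (c₀Five M α₀) (11 / 60)⟫_ℝ) := by ring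
    _ ≤ 2 * α₀ * (c₀Five M α₀ / 2) := mul_le_mul_of_nonneg_left h2 (by positivity)
    _ = _ := by
        rw [c₀Five]
        field_simp

/-- The primitive of the subgradient takes values in `[-1, 1]`. The gaps between `leftProfile M 5`,
`leftProfile M 4` and `leftProfile M 3` do not depend on `n`, and the choice of `c₀` keeps the jump
over `I_1` below them. -/
theorem exists_const_subgradient (hM : 2 ≤ M) (hα : 0 < α₀) (n : ℕ) :
    ∃ c : ℝ, ∀ m, |c + ∑ i ∈ Finset.range m, 2 * (-1) ^ (i + 1)
      * (subgradientCoeff M α₀ n (i + 1) / Real.sqrt ((i + 1 : ℕ) : ℝ))| ≤ 1 := by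
  have hx : 0 < M⁻¹ := inv_pos.2 (by linarith)
  have hx1 : M⁻¹ ≤ 1 := by linarith [inv_le_half hM]
  have hK := leftProfile_five_pos hM
  have hK1 := leftProfile_five_le_one hM
  obtain ⟨h0, h1⟩ := subgradientCoeff_one hM hα n
  have hone : subgradientCoeff M α₀ n 1 / Real.sqrt ((1 : ℕ) : ℝ) = subgradientCoeff M α₀ n 1 := by
    simp
  have h6 : M⁻¹ ^ 6 ≤ M⁻¹ ^ 5 := pow_le_pow_of_le_one hx.le hx1 (by norm_num)
  have h60 : 0 ≤ M⁻¹ ^ 6 := by positivity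
  refine exists_const_abs_add_sum_le
    (D := fun j => subgradientCoeff M α₀ n j / Real.sqrt (j : ℝ))
    (E := fun s => leftProfile M (5 - s) / leftProfile M 5)
    (F := fun l => rightProfile M l / leftProfile M 5) (n := n)
    ?_ ?_ ?_ ?_ ?_ ?_ ?_ ?_ ?_ ?_ ?_ ?_
  · exact fun i j hij => div_le_div_of_nonneg_right (leftProfile_mono hM (by omega)) hK.le
  · exact fun i j hij => div_le_div_of_nonneg_right (rightProfile_antitone hM hij) hK.le
  · exact fun i => div_nonneg (leftProfile_nonneg hM _) hK.le
  · exact fun i => div_nonneg (rightProfile_nonneg hM _) hK.le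
  · exact div_self hK.ne'
  · simp only [rightProfile_zero]
    exact div_self hK.ne'
  · exact fun s hs => subgradientCoeff_left hM hα hs
  · exact fun l => subgradientCoeff_right hM hα n l
  · rw [hone]
    exact h0
  · rw [hone]
    have : M⁻¹ ^ 6 ≤ 1 := pow_le_one₀ hx.le hx1
    linarith
  · rw [hone, show (1 : ℝ) - leftProfile M (5 - 1) / leftProfile M 5
        = (leftProfile M 5 - leftProfile M 4) / leftProfile M 5 by rw [sub_div, div_self hK.ne'],
      le_div_iff₀ hK]
    have h2 := leftProfile_succ_sub M (show 4 ≤ 5 by norm_num)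
    norm_num at h2 ⊢
    rw [← inv_pow] at h2
    have h3 := mul_le_of_le_one_right h0 hK1
    linarith
  · rw [hone, ← sub_div, le_div_iff₀ hK]
    have h2 := leftProfile_succ_sub M (show 3 ≤ 5 by norm_num)
    norm_num at h2 ⊢
    rw [← inv_pow] at h2
    have h3 := mul_le_of_le_one_right h0 hK1
    linarith

/-! ### The multiscale sequence -/

theorem sum_range_add_eq_σ (b : ℝ) (n : ℕ) :
    ∑ j ∈ Finset.range n, (b / Real.sqrt ((j : ℝ) + 2)) • e (j + 2)
      + (b / Real.sqrt ((n : ℝ) + 2)) • e (n + 2) = σ b n := by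
  rw [σ, Finset.sum_range_succ]

theorem isMinimizer_smul_e (hM : 2 ≤ M) (hα : 0 < α₀) (n : ℕ) :
    IsMinimizer (Λ M 5 (c₀Five M α₀) (bFive M α₀) (11 / 60))
      (Λ M 5 (c₀Five M α₀) (bFive M α₀) (11 / 60) (e 1)) (α₀ * M ^ n)
      (∑ j ∈ Finset.range n, (bFive M α₀ / Real.sqrt ((j : ℝ) + 2)) • e (j + 2))
      ((bFive M α₀ / Real.sqrt ((n : ℝ) + 2)) • e (n + 2)) := by
  have h := admissible_c₀Five hM hα
  have hb := h.b_pos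
  have hM0 : 0 < M := h.M_pos
  have hsq : 0 < Real.sqrt ((n : ℝ) + 2) := Real.sqrt_pos.2 (by positivity)
  have hvalue : 2 * (α₀ * M ^ n) * ⟪residual M 5 (c₀Five M α₀) (bFive M α₀) (11 / 60) n,
      Λ M 5 (c₀Five M α₀) (bFive M α₀) (11 / 60)
        ((bFive M α₀ / Real.sqrt ((n : ℝ) + 2)) • e (n + 2))⟫_ℝ = bFive M α₀ := by
    have h1 := subgradientCoeff_right hM hα n 0
    rw [rightProfile_zero, div_self (leftProfile_five_pos hM).ne', add_zero,
      div_eq_one_iff_eq (Real.sqrt_pos.2 (by positivity)).ne', subgradientCoeff] at h1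
    push_cast at h1
    rw [Λ_smul h, Λ_e h (n + 1), real_inner_smul_right, mul_left_comm, h1]
    field_simp
  refine isMinimizer_of_inner_le_TV h (by positivity) ?_ ?_ ?_
  · intro w
    rw [sum_range_add_eq_σ, ← residual]
    obtain ⟨c, hc⟩ := exists_const_subgradient hM hα n
    have hsum := ((hasSum_inner_Λ h (residual_mem_Htilde h n) w).mul_left
      (2 * (α₀ * M ^ n))).tendsto_sum_nat
    refine le_of_tendsto (ENNReal.tendsto_ofReal hsum) (Eventually.of_forall fun m => ?_)
    refine le_of_eq_of_le (congrArg _ (Finset.sum_congr rfl fun i _ => ?_))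
      (ofReal_sum_inner_e_le_TV (q := subgradientCoeff M α₀ n) (n := m) (fun i _ => hc i) w)
    rw [subgradientCoeff]
    ring
  · rw [sum_range_add_eq_σ, ← residual, hvalue]
    exact hb.le
  · rw [sum_range_add_eq_σ, ← residual, hvalue]
    have h1 := TV_sum_smul_e_le {n} (fun j => bFive M α₀ / Real.sqrt ((j : ℝ) + 2)) (fun j => j + 2)
    rw [Finset.sum_singleton, Finset.sum_singleton] at h1
    refine h1.trans (ENNReal.ofReal_le_ofReal (le_of_eq ?_))
    rw [abs_of_nonneg (by positivity)]
    push_cast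
    field_simp

theorem isMultiscaleSeq_iff (hM : 2 ≤ M) (hα : 0 < α₀) (τ : ℕ → L2) :
    IsMultiscaleSeq (Λ M 5 (c₀Five M α₀) (bFive M α₀) (11 / 60))
      (Λ M 5 (c₀Five M α₀) (bFive M α₀) (11 / 60) (e 1)) (fun n => α₀ * M ^ n) τ
        ↔ τ = σ (bFive M α₀) := by
  have h := admissible_c₀Five hM hα
  constructor
  · rintro ⟨u, hu, hτ⟩
    have hu' : ∀ n, u n = (bFive M α₀ / Real.sqrt ((n : ℝ) + 2)) • e (n + 2) := by
      intro n
      induction n using Nat.strong_induction_on with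
      | _ n ih =>
        have h1 := hu n
        rw [Finset.sum_congr rfl fun j hj => ih j (Finset.mem_range.1 hj)] at h1
        exact h1.eq h (mul_pos hα (pow_pos h.M_pos n)) (isMinimizer_smul_e hM hα n)
    funext n
    rw [hτ, σ]
    exact Finset.sum_congr rfl fun j _ => hu' j
  · rintro rfl
    exact ⟨fun j => (bFive M α₀ / Real.sqrt ((j : ℝ) + 2)) • e (j + 2),
      fun n => isMinimizer_smul_e hM hα n, fun n => rfl⟩

end MultiscaleBlur

theorem theorem4p5 :
    -- the blurring operator and the unique solvability of the regularized problems
    (∀ (M : ℝ) (k : ℕ) (c₀ b δ : ℝ), 2 ≤ M → 3 ≤ k → 0 < c₀ → 0 < b → 0 < δ → δ < 1 / (k : ℝ) →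
      (∃ T : MultiscaleBlur.L2 →L[ℝ] MultiscaleBlur.L2, ∀ w, T w = MultiscaleBlur.Λ M k c₀ b δ w) ∧
      Function.Injective (MultiscaleBlur.Λ M k c₀ b δ) ∧
      Summable (fun m : ℕ => MultiscaleBlur.η M c₀ (k + 1 + m) • MultiscaleBlur.e (k + 1 + m)) ∧
      MultiscaleBlur.Λ M k c₀ b δ (MultiscaleBlur.e 1) = MultiscaleBlur.image₁ M k c₀ δ ∧
      (∀ j : ℕ, 2 ≤ j →
        MultiscaleBlur.Λ M k c₀ b δ (MultiscaleBlur.e j) = MultiscaleBlur.image₂ M k c₀ b δ j) ∧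
      (∀ (γ : ℕ → ℝ) (u : MultiscaleBlur.L2),
        HasSum (fun j : ℕ => γ (j + 1) • MultiscaleBlur.e (j + 1)) u →
        HasSum (fun j : ℕ => γ (j + 1) • MultiscaleBlur.Λ M k c₀ b δ (MultiscaleBlur.e (j + 1)))
          (MultiscaleBlur.Λ M k c₀ b δ u)) ∧
      (∀ w ∈ MultiscaleBlur.Htildeᗮ, MultiscaleBlur.Λ M k c₀ b δ w = w) ∧
      (∀ (f s : MultiscaleBlur.L2) (lam : ℝ), 0 < lam →
        ∃! u : MultiscaleBlur.L2,
          MultiscaleBlur.IsMinimizer (MultiscaleBlur.Λ M k c₀ b δ) f lam s u)) ∧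
    -- the three norms of the partial sums, all of which diverge, and no subsequence converges
    (∀ b : ℝ, 0 < b →
      (∀ n : ℕ, ‖MultiscaleBlur.σ b n‖ ^ 2 = b ^ 2 * ∑ j ∈ Finset.Icc 2 (n + 2), 1 / (j : ℝ)) ∧
      (∀ n : ℕ, eLpNorm (MultiscaleBlur.σ b n) 1 volume
        = ENNReal.ofReal (2 * b * ∑ j ∈ Finset.Icc 2 (n + 2), 1 / (j : ℝ))) ∧
      (∀ n : ℕ, MultiscaleBlur.TV (MultiscaleBlur.σ b n) = ENNReal.ofReal (b * ((n : ℝ) + 1))) ∧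
      Tendsto (fun n : ℕ => ‖MultiscaleBlur.σ b n‖) atTop atTop ∧
      Tendsto (fun n : ℕ => eLpNorm (MultiscaleBlur.σ b n) 1 volume) atTop (𝓝 ⊤) ∧
      Tendsto (fun n : ℕ => MultiscaleBlur.TV (MultiscaleBlur.σ b n)) atTop (𝓝 ⊤) ∧
      ∀ (p : ℕ → ℕ) (l : MultiscaleBlur.L2), StrictMono p →
        ¬ Tendsto (fun n : ℕ => MultiscaleBlur.σ b (p n)) atTop (𝓝 l)) ∧
    -- for suitable constants the partial sums are the one and only multiscale sequence
    (∀ M α₀ : ℝ, 2 ≤ M → 0 < α₀ →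
      ∃ c₀ b δ : ℝ, 0 < c₀ ∧ 0 < b ∧ 0 < δ ∧ δ < 1 / 5 ∧
        ∀ τ : ℕ → MultiscaleBlur.L2,
          MultiscaleBlur.IsMultiscaleSeq (MultiscaleBlur.Λ M 5 c₀ b δ)
            (MultiscaleBlur.Λ M 5 c₀ b δ (MultiscaleBlur.e 1)) (fun n => α₀ * M ^ n) τ
          ↔ τ = MultiscaleBlur.σ b) := by
  refine ⟨fun M k c₀ b δ hM hk hc hb hδ hδk => ?_, fun b hb => ?_, fun M α₀ hM hα => ?_⟩
  · have h : MultiscaleBlur.Admissible M k c₀ b δ := ⟨hM, hk, hc, hb, hδ, hδk⟩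
    refine ⟨⟨MultiscaleBlur.ΛL M k c₀ b δ, MultiscaleBlur.ΛL_apply h⟩,
      MultiscaleBlur.Λ_injective h, MultiscaleBlur.summable_η_smul_e h, ?_, fun j hj => ?_,
      fun γ u hu => MultiscaleBlur.hasSum_smul_Λ_e h hu,
      fun w hw => MultiscaleBlur.Λ_of_mem_orthogonal hw,
      fun f s lam hlam => MultiscaleBlur.existsUnique_isMinimizer h f s hlam⟩
    · rw [MultiscaleBlur.Λ_e h 0, MultiscaleBlur.image_one]
    · obtain ⟨i, rfl⟩ := Nat.exists_eq_add_of_le' (by omega : 1 ≤ j)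
      rw [MultiscaleBlur.Λ_e h i, MultiscaleBlur.image_of_two_le hj]
  · exact ⟨MultiscaleBlur.norm_σ_sq b, MultiscaleBlur.eLpNorm_one_σ hb, MultiscaleBlur.TV_σ hb,
      MultiscaleBlur.tendsto_norm_σ hb, MultiscaleBlur.tendsto_eLpNorm_one_σ hb,
      MultiscaleBlur.tendsto_TV_σ hb, fun p l hp => MultiscaleBlur.not_tendsto_σ_comp hb hp l⟩
  · exact ⟨MultiscaleBlur.c₀Five M α₀, MultiscaleBlur.bFive M α₀, 11 / 60,
      MultiscaleBlur.c₀Five_pos hM hα, MultiscaleBlur.bFive_pos hM hα, by norm_num, by norm_num,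
      MultiscaleBlur.isMultiscaleSeq_iff hM hα⟩
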